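/- Consider an electric network on the square lattice $\mathbb Z^2$ with nearest-neighbour edges, each edge $e$ carrying an arbitrary resistance $r_e\in(0,\infty)$. For integers $n\ge 0$ let $B(n)=[-n,n]^2\cap\mathbb Z^2$ and let $\partial B(n)=\{x\in\mathbb Z^2:\|x\|_\infty=n\}$. Let $0\le r_1<r_2<r_3<r_4$ be integers and put $\mathcal A=B(r_3)\setminus B(r_2)$, $\mathcal B=B(r_4)\setminus B(r_3)$, $A=\partial B(r_1)$, $Z=\partial B(r_4)$. For $v\in B(r_2)\setminus B(r_1)$ let $R(v,Z)$, $R(A,Z)$ and $R(v,A)$ be the effective resistances in the network in which all points of $A$ are identified to one vertex and all points of $Z$ are identified to one vertex; here the effective resistance between two vertices is the infimum of the energies $\sum_e\theta(e)^2r_e$ over the finitely supported unit flows $\theta$ from one to the other. Let $R(\text{across }\mathcal B)$ be the effective resistance between $\partial B(r_3)$ and $\partial B(r_4)$, each identified to one vertex. Let $R(\text{around }\mathcal A)=\inf\big(\sum_{k}\big(\sum_{e\in P_k}r_{e,P_k}\big)^{-1}\big)^{-1}$, where the infimum is over all finite nonempty sets $\{P_1,\dots,P_m\}$ of contours around $\mathcal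 A$ (edge sets of simple lattice cycles with all vertices in $\mathcal A$ that wind around its hole) and all positive numbers $r_{e,P_k}$ with $\sum_{k:\,e\in P_k}1/r_{e,P_k}\le 1/r_e$ for every edge $e$. (i) For every $C>0$ there is $r=r(C)>0$, depending only on $C$, such that for every such network, all such $r_1,r_2,r_3,r_4$ and every $v\in B(r_2)\setminus B(r_1)$: if $R(\text{around }\mathcal A)\le C\,R(\text{across }\mathcal B)$, then $$R(v,Z)+R(A,Z)-R(v,A)\ \ge\ r\,R(\text{around }\mathcal A).$$ (ii) For all $c,C>0$ there is $q=q(c,C)\in(0,1)$, depending only on $c$ and $C$, such that for every such network, all such $r_1,r_2,r_3,r_4$ and every $v\in B(r_2)\setminus B(r_1)$: if $c\,R(A,Z)\le R(\text{around }\mathcal A)\le C\,R(\text{across }\mathcal B)$, then the random walk on the network started at $v$ (which at each step moves to a neighbour with probability proportional to the conductance $1/r_e$ of the connecting edge) satisfies $$P^v(\tau_A<\tau_Z)\ \ge\ q,$$ where $\tau_A$ and $\tau_Z$ are the hitting times of $A$ and $Z$. -/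

import Mathlib

open MeasureTheory

noncomputable section

/-- An electric network on a graph `G`: a positive resistance on each edge of `G`
(the values of `res` outside the edge set are irrelevant and never used). -/
structure Network {V : Type*} (G : SimpleGraph V) where
  res : Sym2 V → ℝ
  res_pos : ∀ e ∈ G.edgeSet, 0 < res e

/-- The net flow out of the vertex `x`. -/
def netOut {V : Type*} (θ : V → V → ℝ) (x : V) : ℝ :=
  ∑ᶠ y, θ x y

/-- `θ` is a unit flow from `S` to `T` in the network obtained from `G` by identifying `S` to a
single vertex, `T` to a single vertex, and `U` to a single vertex (the sets `S`, `T`, `U` being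
disjoint; `U` may be empty, in which case nothing more is identified). Flows are antisymmetric,
live on the edges of `G`, and have finite support. Since `S`, `T`, `U` count as single vertices,
only their total net flows are prescribed: `1` for the source, `-1` for the sink and, by
Kirchhoff's node law, `0` for `U`. -/
structure IsUnitFlow {V : Type*} (G : SimpleGraph V) (S T U : Set V) (θ : V → V → ℝ) :
    Prop where
  antisymm : ∀ x y, θ x y = -θ y x
  eq_zero_of_not_adj : ∀ x y, ¬ G.Adj x y → θ x y = 0
  finite_support : {p : V × V | θ p.1 p.2 ≠ 0}.Finite
  node_law : ∀ x, x ∉ S → x ∉ T → x ∉ U → netOut θ x = 0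
  source : ∑ᶠ x ∈ S, netOut θ x = 1
  sink : ∑ᶠ x ∈ T, netOut θ x = -1
  node_law_glued : ∑ᶠ x ∈ U, netOut θ x = 0

namespace Network

variable {V : Type*} {G : SimpleGraph V}

/-- The energy `∑_e θ(e)² r_e`, as half of the sum over directed edges. -/
def energy (N : Network G) (θ : V → V → ℝ) : ℝ :=
  (1 / 2) * ∑ᶠ p : V × V, θ p.1 p.2 ^ 2 * N.res s(p.1, p.2)

/-- The effective resistance between `S` and `T`, each identified to a single vertex, in the
network in which `U` is identified to a single vertex as well: the infimum of the energies of the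
unit flows from `S` to `T`. -/
def effRes (N : Network G) (S T U : Set V) : ℝ :=
  sInf {E : ℝ | ∃ θ : V → V → ℝ, IsUnitFlow G S T U θ ∧ E = N.energy θ}

/-- The effective resistance of a collection `F` of edge sets:
`inf (∑_k (∑_{e ∈ P_k} ρ_{e,P_k})⁻¹)⁻¹`, over all finite nonempty sets `I = {P_1, …, P_n} ⊆ F` and
all positive `ρ_{e,P_k}` with `∑_{k : e ∈ P_k} 1 / ρ_{e,P_k} ≤ 1 / r_e` for each edge `e`. -/
def familyRes [DecidableEq V] (N : Network G) (F : Set (Finset (Sym2 V))) : ℝ :=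
  sInf {R : ℝ | ∃ (I : Finset (Finset (Sym2 V))) (ρ : Sym2 V → Finset (Sym2 V) → ℝ),
    I.Nonempty ∧ (∀ P ∈ I, P ∈ F) ∧ (∀ e P, 0 < ρ e P) ∧
    (∀ e ∈ G.edgeSet, ∑ P ∈ I with e ∈ P, 1 / ρ e P ≤ 1 / N.res e) ∧
    R = (∑ P ∈ I, (∑ e ∈ P, ρ e P)⁻¹)⁻¹}

open Classical in
/-- The conductance between two vertices: the reciprocal of the resistance if they are adjacent,
`0` otherwise. -/
def conductance (N : Network G) (x y : V) : ℝ :=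
  if G.Adj x y then (N.res s(x, y))⁻¹ else 0

/-- The transition probability of the random walk on the network: from `x` it moves to a neighbour,
chosen with probability proportional to the conductance. -/
def transProb (N : Network G) (x y : V) : ℝ :=
  N.conductance x y / ∑ᶠ z, N.conductance x z

/-- `X` is (a realization of) the random walk on the network `N` started at `v`: the Markov chain
with transition probabilities `N.transProb` and initial state `v`, described by its
finite-dimensional distributions. -/
structure IsRandomWalk [MeasurableSpace V] (N : Network G) (v : V) {Ω : Type*} [MeasurableSpace Ω]
    (μ : Measure Ω) (X : ℕ → Ω → V) : Prop where
  measurable : ∀ n, Measurable (X n)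
  start : μ {ω | X 0 ω = v} = 1
  law : ∀ (n : ℕ) (x : ℕ → V), x 0 = v →
    μ {ω | ∀ i ≤ n, X i ω = x i} =
      ∏ i ∈ Finset.range n, ENNReal.ofReal (N.transProb (x i) (x (i + 1)))

end Network

/-- The square lattice `ℤ²` with its nearest-neighbour edges. -/
def squareLattice : SimpleGraph (ℤ × ℤ) where
  Adj x y := |x.1 - y.1| + |x.2 - y.2| = 1
  symm := ⟨fun x y h => by rwa [abs_sub_comm y.1, abs_sub_comm y.2]⟩
  loopless := ⟨fun x h => by simp at h⟩

/-- The box `B(n) = [-n, n]² ∩ ℤ²`. -/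
def box (n : ℤ) : Set (ℤ × ℤ) := {x | max |x.1| |x.2| ≤ n}

/-- The boundary `∂B(n)`: the points of the box `B(n)` on its four sides, which are the points of
`B(n)` with a neighbour outside `B(n)`. In particular `∂B(0) = {0}`. -/
def boxBoundary (n : ℤ) : Set (ℤ × ℤ) := {x | max |x.1| |x.2| = n}

/-- The signed crossing of the half-line `{(t, 1/2) : t > 1/2}` by the lattice step from `x` to
`y`: `1` for an upward crossing, `-1` for a downward crossing, `0` if there is none. -/
def rayCrossing (x y : ℤ × ℤ) : ℤ :=
  if 0 < x.1 ∧ y.1 = x.1 ∧ x.2 = 0 ∧ y.2 = 1 then 1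
  else if 0 < x.1 ∧ y.1 = x.1 ∧ x.2 = 1 ∧ y.2 = 0 then -1
  else 0

/-- The winding number, around the point `(1/2, 1/2)`, of a closed lattice walk. -/
def windingNumber {x : ℤ × ℤ} (w : squareLattice.Walk x x) : ℤ :=
  (w.darts.map fun d => rayCrossing d.fst d.snd).sum

/-- The contours around the annulus `B(n) \ B(m)`, `1 ≤ m < n`, as edge sets: the simple lattice
cycles with all vertices in `B(n) \ B(m)` that separate the inner from the outer boundary of the
annulus, that is, which wind around its hole. (The point `(1/2, 1/2)` lies in the hole
`[-m, m]²`, so such a simple closed curve encloses the hole if and only if its winding number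
around that point is not zero.) -/
def contours (m n : ℤ) : Set (Finset (Sym2 (ℤ × ℤ))) :=
  {P | ∃ (x : ℤ × ℤ) (w : squareLattice.Walk x x), w.IsCycle ∧
    (∀ y ∈ w.support, y ∈ box n \ box m) ∧ windingNumber w ≠ 0 ∧ P = w.edges.toFinset}

namespace Network

/-- `R(around B(n) \ B(m))`: the effective resistance of the collection of contours around the
annulus. -/
def resAround (N : Network squareLattice) (m n : ℤ) : ℝ :=
  N.familyRes (contours m n)

/-- `R(across B(n) \ B(m))`: the effective resistance between `∂B(m)` and `∂B(n)`. -/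
def resAcross (N : Network squareLattice) (m n : ℤ) : ℝ :=
  N.effRes (boxBoundary m) (boxBoundary n) ∅

end Network

end

/-! ### Flows, energy and Thomson's principle -/

noncomputable section

/-! Let a be the Green function of A with Z grounded: the potential created by a unit current from A
to Z. It satisfies a(A) = R(A,Z) (`effRes_boundary`), R(v,Z) + R(A,Z) - R(v,A) = 2a(v)
(`effRes_add_effRes_sub_effRes`, by the symmetry of Green functions), and P^v(τ_A < τ_Z) ≥ a(v)/a(A)
(`IsGreen.div_le_measure`). Both claims thus follow from the single bound R(around 𝒜) ≤ C e^{√C}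
a(v), which is `resAround_le`.

That bound is a Harnack inequality. Let η be the Green function of ∂B(r₃) with Z grounded, so that
its value there is ρ = R(across ℬ). Some point of ∂B(r₃) has a ≥ ρ (`exists_boundary_ge`). By the
maximum principle every contour around 𝒜 meets {a ≤ a(v)} and {a ≥ ρ} (`exists_le_of_inside`,
`exists_ge_of_outside`). If a(v) < ρ, log a therefore oscillates by at least L = log(ρ/a(v)) along
each contour.

On the other hand, testing the equation of a against φ²/a with the cutoff φ = η/ρ shows that log a
has energy at most that of φ in B(r₃), namely 1/ρ (`sum_log_sq_le`). Cauchy–Schwarz between lengths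
and resistances (`sq_le_mul_familyRes`) gives L² ≤ R(around 𝒜)/ρ ≤ C. Hence ρ ≤ e^{√C} a(v), and
R(around 𝒜) ≤ Cρ finishes. In the proof a + ε replaces a in the logarithms, and ε tends to 0. -/

theorem IsUnitFlow.sum_mul_netOut {V : Type*} {G : SimpleGraph V} {S T U : Set V} {θ : V → V → ℝ}
    (hθ : IsUnitFlow G S T U θ) (F : Finset V) (hF : ∀ x y, θ x y ≠ 0 → x ∈ F) {f : V → ℝ}
    {a b d : ℝ} (hS : ∀ x ∈ S, f x = a) (hT : ∀ x ∈ T, f x = b) (hU : ∀ x ∈ U, f x = d)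
    (hST : Disjoint S T) (hSU : Disjoint S U) (hTU : Disjoint T U) :
    ∑ x ∈ F, f x * netOut θ x = a - b := by
  classical
  have hnet : ∀ x, netOut θ x ≠ 0 → x ∈ F := by
    intro x hx
    by_contra hxF
    apply hx
    unfold netOut
    have : ∀ y, θ x y = 0 := fun y => by
      by_contra h
      exact hxF (hF x y h)
    simp [this]
  have key : ∀ W : Set V, ∑ᶠ x ∈ W, netOut θ x = ∑ x ∈ F, W.indicator (netOut θ) x := by
    intro W
    rw [finsum_mem_def]
    apply finsum_eq_sum_of_support_subset
    intro x hx
    rw [Function.mem_support, Set.indicator_apply_ne_zero] at hx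
    exact hnet x hx.2
  have e1 := hθ.source
  have e2 := hθ.sink
  have e3 := hθ.node_law_glued
  rw [key] at e1 e2 e3
  have : ∀ x ∈ F, f x * netOut θ x = a * S.indicator (netOut θ) x + b * T.indicator (netOut θ) x
      + d * U.indicator (netOut θ) x := by
    intro x _
    by_cases h1 : x ∈ S
    · have h2 := Set.disjoint_left.1 hST h1
      have h3 := Set.disjoint_left.1 hSU h1
      simp [h1, h2, h3, hS x h1]
    by_cases h2 : x ∈ T
    · have h3 := Set.disjoint_left.1 hTU h2
      simp [h1, h2, h3, hT x h2]
    by_cases h3 : x ∈ U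
    · simp [h1, h2, h3, hU x h3]
    simp [h1, h2, h3, hθ.node_law x h1 h2 h3]
  rw [Finset.sum_congr rfl this, Finset.sum_add_distrib, Finset.sum_add_distrib, ← Finset.mul_sum,
    ← Finset.mul_sum, ← Finset.mul_sum, e1, e2, e3]
  ring

/-- Summation by parts; the factor 2 appears because each edge is counted in both directions. -/
theorem sum_antisymm_mul_sub {V : Type*} {θ : V → V → ℝ} (hθ : ∀ x y, θ x y = -θ y x)
    (F : Finset V) (f : V → ℝ) :
    ∑ x ∈ F, ∑ y ∈ F, θ x y * (f x - f y) = 2 * ∑ x ∈ F, f x * ∑ y ∈ F, θ x y := by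
  have h1 : ∑ x ∈ F, ∑ y ∈ F, θ x y * f y = -∑ x ∈ F, ∑ y ∈ F, θ x y * f x := by
    rw [Finset.sum_comm, ← Finset.sum_neg_distrib]
    refine Finset.sum_congr rfl fun x _ => ?_
    rw [← Finset.sum_neg_distrib]
    refine Finset.sum_congr rfl fun y _ => ?_
    rw [hθ y x]; ring
  simp only [mul_sub, Finset.sum_sub_distrib, h1]
  have h2 : ∑ x ∈ F, ∑ y ∈ F, θ x y * f x = ∑ x ∈ F, f x * ∑ y ∈ F, θ x y := by
    refine Finset.sum_congr rfl fun x _ => ?_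
    rw [Finset.mul_sum]
    exact Finset.sum_congr rfl fun y _ => mul_comm _ _
  rw [h2]; ring

theorem netOut_eq_sum {V : Type*} {θ : V → V → ℝ} {F : Finset V} (x : V)
    (hF : ∀ y, θ x y ≠ 0 → y ∈ F) : netOut θ x = ∑ y ∈ F, θ x y :=
  finsum_eq_sum_of_support_subset _ fun y hy => hF y hy

namespace Network

variable {V : Type*} {G : SimpleGraph V}

theorem conductance_symm (N : Network G) (x y : V) : N.conductance x y = N.conductance y x := by
  unfold conductance
  by_cases h : G.Adj x y
  · rw [if_pos h, if_pos h.symm, Sym2.eq_swap]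
  · rw [if_neg h, if_neg fun h' => h h'.symm]

theorem conductance_pos (N : Network G) {x y : V} (h : G.Adj x y) : 0 < N.conductance x y := by
  unfold conductance
  rw [if_pos h]
  exact inv_pos.2 (N.res_pos _ h)

theorem conductance_nonneg (N : Network G) (x y : V) : 0 ≤ N.conductance x y := by
  by_cases h : G.Adj x y
  · exact (N.conductance_pos h).le
  · simp [conductance, h]

theorem adj_of_conductance_ne_zero (N : Network G) {x y : V} (h : N.conductance x y ≠ 0) :
    G.Adj x y := by
  by_contra h'
  simp [conductance, h'] at h

/-- The current driven by the potential `f`. -/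
def current (N : Network G) (f : V → ℝ) (x y : V) : ℝ := N.conductance x y * (f x - f y)

theorem current_antisymm (N : Network G) (f : V → ℝ) (x y : V) :
    N.current f x y = -N.current f y x := by
  unfold current
  rw [N.conductance_symm x y]; ring

theorem energy_eq_sum (N : Network G) {θ : V → V → ℝ} {F : Finset V}
    (hF : ∀ x y, θ x y ≠ 0 → x ∈ F ∧ y ∈ F) :
    N.energy θ = 1 / 2 * ∑ x ∈ F, ∑ y ∈ F, θ x y ^ 2 * N.res s(x, y) := by
  unfold energy
  rw [← Finset.sum_product', finsum_eq_sum_of_support_subset]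
  rintro ⟨x, y⟩ h
  rw [Function.mem_support] at h
  have : θ x y ≠ 0 := fun h0 => h (by simp [h0])
  simpa using hF x y this

/-- Thomson's principle: a potential whose current is a unit flow realizes the effective
resistance. -/
theorem effRes_eq_of_current (N : Network G) {S T U : Set V} {f : V → ℝ} {a b d : ℝ}
    (hθ : IsUnitFlow G S T U (N.current f))
    (hS : ∀ x ∈ S, f x = a) (hT : ∀ x ∈ T, f x = b) (hU : ∀ x ∈ U, f x = d)
    (hST : Disjoint S T) (hSU : Disjoint S U) (hTU : Disjoint T U) :
    N.effRes S T U = a - b := by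
  classical
  -- Every unit flow has the same pairing with the gradient of `f`, so the current is
  -- energy-orthogonal to differences of unit flows.
  have cross : ∀ (θ : V → V → ℝ), IsUnitFlow G S T U θ → ∀ F : Finset V,
      (∀ x y, θ x y ≠ 0 → x ∈ F ∧ y ∈ F) →
      1 / 2 * ∑ x ∈ F, ∑ y ∈ F, θ x y * (f x - f y) = a - b := by
    intro θ h F hF
    rw [sum_antisymm_mul_sub h.antisymm,
      ← h.sum_mul_netOut F (fun x y hxy => (hF x y hxy).1) hS hT hU hST hSU hTU]
    rw [← mul_assoc]
    norm_num
    refine Finset.sum_congr rfl fun x _ => ?_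
    rw [netOut_eq_sum x fun y hy => (hF x y hy).2]
  have exF : ∀ (θ : V → V → ℝ), IsUnitFlow G S T U θ → ∃ F : Finset V,
      ∀ x y, θ x y ≠ 0 → x ∈ F ∧ y ∈ F := by
    intro θ h
    refine ⟨h.finite_support.toFinset.image Prod.fst ∪ h.finite_support.toFinset.image Prod.snd,
      fun x y hxy => ⟨?_, ?_⟩⟩
    · refine Finset.mem_union_left _ (Finset.mem_image.2 ⟨(x, y), ?_, rfl⟩)
      simpa using hxy
    · refine Finset.mem_union_right _ (Finset.mem_image.2 ⟨(x, y), ?_, rfl⟩)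
      simpa using hxy
  have energy0 : ∀ x y, N.current f x y ^ 2 * N.res s(x, y) = N.current f x y * (f x - f y) := by
    intro x y
    by_cases h : G.Adj x y
    · have := N.res_pos _ (G.mem_edgeSet.2 h)
      simp only [current, conductance, if_pos h]
      field_simp
    · simp [current, conductance, h]
  have hle : IsLeast {E : ℝ | ∃ θ : V → V → ℝ, IsUnitFlow G S T U θ ∧ E = N.energy θ} (a - b) := by
    constructor
    · refine ⟨_, hθ, ?_⟩
      obtain ⟨F, hF⟩ := exF _ hθ
      rw [N.energy_eq_sum hF, ← cross _ hθ F hF]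
      simp only [energy0]
    · rintro E ⟨θ, h, rfl⟩
      obtain ⟨F₁, hF₁⟩ := exF _ hθ
      obtain ⟨F₂, hF₂⟩ := exF _ h
      have h1 : ∀ x y, N.current f x y ≠ 0 → x ∈ F₁ ∪ F₂ ∧ y ∈ F₁ ∪ F₂ := fun x y hxy =>
        ⟨Finset.mem_union_left _ (hF₁ x y hxy).1, Finset.mem_union_left _ (hF₁ x y hxy).2⟩
      have h2 : ∀ x y, θ x y ≠ 0 → x ∈ F₁ ∪ F₂ ∧ y ∈ F₁ ∪ F₂ := fun x y hxy =>
        ⟨Finset.mem_union_right _ (hF₂ x y hxy).1, Finset.mem_union_right _ (hF₂ x y hxy).2⟩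
      have c1 := cross _ hθ _ h1
      have c2 := cross _ h _ h2
      rw [N.energy_eq_sum h2]
      -- Edgewise this is (θr - df)²/r ≥ 0. By `cross`, half of the left side is 2(a - b) - (a - b).
      have : ∑ x ∈ F₁ ∪ F₂, ∑ y ∈ F₁ ∪ F₂, (2 * (θ x y * (f x - f y))
          - N.current f x y * (f x - f y)) ≤
          ∑ x ∈ F₁ ∪ F₂, ∑ y ∈ F₁ ∪ F₂, θ x y ^ 2 * N.res s(x, y) := by
        refine Finset.sum_le_sum fun x _ => Finset.sum_le_sum fun y _ => ?_
        by_cases hxy : G.Adj x y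
        · have hr := N.res_pos _ (G.mem_edgeSet.2 hxy)
          simp only [current, conductance, if_pos hxy]
          have : θ x y ^ 2 * N.res s(x, y) - (2 * (θ x y * (f x - f y))
              - (N.res s(x, y))⁻¹ * (f x - f y) * (f x - f y))
              = (θ x y * N.res s(x, y) - (f x - f y)) ^ 2 * (N.res s(x, y))⁻¹ := by
            field_simp
            ring
          have h3 : 0 ≤ (θ x y * N.res s(x, y) - (f x - f y)) ^ 2 * (N.res s(x, y))⁻¹ := by
            positivity
          linarith
        · simp [current, conductance, hxy, h.eq_zero_of_not_adj x y hxy]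
      simp only [Finset.sum_sub_distrib, ← Finset.mul_sum] at this
      linarith
  exact hle.csInf_eq

end Network

/-! ### Boxes and the maximum principle on the lattice -/

/-- The sup norm on the square lattice. -/
def supNorm (x : ℤ × ℤ) : ℤ := max |x.1| |x.2|

theorem supNorm_le {x : ℤ × ℤ} {n : ℤ} :
    supNorm x ≤ n ↔ (-n ≤ x.1 ∧ x.1 ≤ n) ∧ (-n ≤ x.2 ∧ x.2 ≤ n) := by
  unfold supNorm
  rw [max_le_iff, abs_le, abs_le]

theorem mem_box {x : ℤ × ℤ} {n : ℤ} : x ∈ box n ↔ supNorm x ≤ n := Iff.rfl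

theorem mem_boxBoundary {x : ℤ × ℤ} {n : ℤ} : x ∈ boxBoundary n ↔ supNorm x = n := Iff.rfl

theorem supNorm_zero : supNorm 0 = 0 := by simp [supNorm]

theorem supNorm_le_of_adj {x y : ℤ × ℤ} (h : squareLattice.Adj x y) :
    supNorm y ≤ supNorm x + 1 := by
  have h' : |x.1 - y.1| + |x.2 - y.2| = 1 := h
  have hx := supNorm_le.1 (le_refl (supNorm x))
  rw [supNorm_le]
  have h1 := abs_le.1 (show |x.1 - y.1| ≤ 1 by linarith [abs_nonneg (x.2 - y.2)])
  have h2 := abs_le.1 (show |x.2 - y.2| ≤ 1 by linarith [abs_nonneg (x.1 - y.1)])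
  omega

theorem adj_right (x : ℤ × ℤ) : squareLattice.Adj x (x.1 + 1, x.2) := by
  show |x.1 - (x.1 + 1)| + |x.2 - x.2| = 1
  simp

/-- The box `B(n)` as a finite set. -/
def boxFinset (n : ℤ) : Finset (ℤ × ℤ) := Finset.Icc (-n) n ×ˢ Finset.Icc (-n) n

theorem mem_boxFinset {x : ℤ × ℤ} {n : ℤ} : x ∈ boxFinset n ↔ supNorm x ≤ n := by
  rw [supNorm_le]; simp [boxFinset]

/-- The maximum principle on the square lattice. -/
theorem le_of_subharmonic {U F : Finset (ℤ × ℤ)} {c : ℤ × ℤ → ℤ × ℤ → ℝ} {f : ℤ × ℤ → ℝ} {b : ℝ}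
    (hc : ∀ x y, 0 ≤ c x y) (hpos : ∀ x, 0 < c x (x.1 + 1, x.2))
    (hF : ∀ x ∈ U, (x.1 + 1, x.2) ∈ F)
    (hsub : ∀ x ∈ U, 0 ≤ ∑ y ∈ F, c x y * (f y - f x))
    (hbdry : ∀ x ∈ U, ∀ y, c x y ≠ 0 → y ∈ U ∨ f y ≤ b) : ∀ x ∈ U, f x ≤ b := by
  by_contra! hcon
  obtain ⟨x₀, hx₀, hlt⟩ := hcon
  obtain ⟨x₁, hx₁, hmax⟩ := U.exists_max_image f ⟨x₀, hx₀⟩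
  have hb : b < f x₁ := hlt.trans_le (hmax _ hx₀)
  -- Take the rightmost maximizer. Subharmonicity makes its right neighbour a maximizer too, so no
  -- connectedness of `U` is needed.
  obtain ⟨x, hx, hright⟩ := (U.filter fun x => f x = f x₁).exists_max_image Prod.fst
    ⟨x₁, Finset.mem_filter.2 ⟨hx₁, rfl⟩⟩
  rw [Finset.mem_filter] at hx
  obtain ⟨hxU, hfx⟩ := hx
  have hle : ∀ y, c x y ≠ 0 → f y ≤ f x := by
    intro y hy
    rcases hbdry x hxU y hy with h | h
    · rw [hfx]; exact hmax y h
    · rw [hfx]; linarith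
  have hterm : ∀ y ∈ F, c x y * (f y - f x) ≤ 0 := by
    intro y _
    by_cases h : c x y = 0
    · simp [h]
    · exact mul_nonpos_of_nonneg_of_nonpos (hc x y) (by linarith [hle y h])
  have hzero := (Finset.sum_eq_zero_iff_of_nonpos hterm).1
    (le_antisymm (Finset.sum_nonpos hterm) (hsub x hxU)) _ (hF x hxU)
  have heq : f (x.1 + 1, x.2) = f x := by
    rcases mul_eq_zero.1 hzero with h | h
    · exact absurd h (hpos x).ne'
    · linarith
  rcases hbdry x hxU _ (hpos x).ne' with h | h
  · have := hright _ (Finset.mem_filter.2 ⟨h, heq.trans hfx⟩)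
    simp at this
  · linarith

/-! ### The Dirichlet form and Green functions -/

namespace Network

/-- The Dirichlet form on the finite vertex set `F`. -/
def dirichlet {V : Type*} {G : SimpleGraph V} (N : Network G) (F : Finset V) :
    (V → ℝ) →ₗ[ℝ] (V → ℝ) →ₗ[ℝ] ℝ :=
  LinearMap.mk₂ ℝ
    (fun f g => 1 / 2 * ∑ x ∈ F, ∑ y ∈ F, N.conductance x y * (f x - f y) * (g x - g y))
    (fun f₁ f₂ g => by
      rw [← mul_add, ← Finset.sum_add_distrib]
      congr 1
      refine Finset.sum_congr rfl fun x _ => ?_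
      rw [← Finset.sum_add_distrib]
      refine Finset.sum_congr rfl fun y _ => ?_
      simp only [Pi.add_apply]; ring)
    (fun a f g => by
      simp only [Pi.smul_apply, smul_eq_mul, Finset.mul_sum]
      refine Finset.sum_congr rfl fun x _ => Finset.sum_congr rfl fun y _ => ?_
      ring)
    (fun f g₁ g₂ => by
      rw [← mul_add, ← Finset.sum_add_distrib]
      congr 1
      refine Finset.sum_congr rfl fun x _ => ?_
      rw [← Finset.sum_add_distrib]
      refine Finset.sum_congr rfl fun y _ => ?_
      simp only [Pi.add_apply]; ring)
    (fun a f g => by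
      simp only [Pi.smul_apply, smul_eq_mul, Finset.mul_sum]
      refine Finset.sum_congr rfl fun x _ => Finset.sum_congr rfl fun y _ => ?_
      ring)

section

variable {V : Type*} {G : SimpleGraph V} (N : Network G) (F : Finset V)

theorem dirichlet_apply (f g : V → ℝ) : N.dirichlet F f g =
    1 / 2 * ∑ x ∈ F, ∑ y ∈ F, N.conductance x y * (f x - f y) * (g x - g y) := rfl

theorem dirichlet_comm (f g : V → ℝ) : N.dirichlet F f g = N.dirichlet F g f := by
  rw [dirichlet_apply, dirichlet_apply]
  congr 1
  refine Finset.sum_congr rfl fun x _ => Finset.sum_congr rfl fun y _ => ?_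
  ring

/-- Green's identity. As currents are antisymmetric, `hF` confines both endpoints to `F`. -/
theorem dirichlet_eq_sum_netOut (f g : V → ℝ)
    (hF : ∀ x y, N.current f x y ≠ 0 → y ∈ F) :
    N.dirichlet F f g = ∑ x ∈ F, g x * netOut (N.current f) x := by
  have h := sum_antisymm_mul_sub (N.current_antisymm f) F g
  rw [dirichlet_apply]
  change 1 / 2 * ∑ x ∈ F, ∑ y ∈ F, N.current f x y * (g x - g y) = _
  rw [h, ← mul_assoc]
  norm_num
  refine Finset.sum_congr rfl fun x _ => ?_
  rw [netOut_eq_sum x fun y hy => hF x y hy]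

end

end Network

/-- The functions that are constant on `B(m)` and vanish outside `B(n - 1)`. -/
def potentialSpace (m n : ℤ) : Submodule ℝ (ℤ × ℤ → ℝ) where
  carrier := {f | (∀ x, supNorm x ≤ m → f x = f 0) ∧ ∀ x, n ≤ supNorm x → f x = 0}
  add_mem' := by
    rintro f g ⟨hf1, hf2⟩ ⟨hg1, hg2⟩
    exact ⟨fun x hx => by simp [hf1 x hx, hg1 x hx], fun x hx => by simp [hf2 x hx, hg2 x hx]⟩
  zero_mem' := ⟨fun _ _ => rfl, fun _ _ => rfl⟩
  smul_mem' := by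
    rintro a f ⟨hf1, hf2⟩
    exact ⟨fun x hx => by simp [hf1 x hx], fun x hx => by simp [hf2 x hx]⟩

instance (m n : ℤ) : FiniteDimensional ℝ (potentialSpace m n) := by
  let L : potentialSpace m n →ₗ[ℝ] (boxFinset n → ℝ) :=
    { toFun := fun f x => f.1 x.1
      map_add' := fun _ _ => rfl
      map_smul' := fun _ _ => rfl }
  refine FiniteDimensional.of_injective L fun f g h => Subtype.ext (funext fun x => ?_)
  by_cases hx : supNorm x ≤ n
  · exact congrFun h ⟨x, mem_boxFinset.2 hx⟩
  · rw [f.2.2 x (by omega), g.2.2 x (by omega)]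

namespace Network

variable (N : Network squareLattice) {m n : ℤ}

theorem supNorm_le_of_current_ne_zero {f : ℤ × ℤ → ℝ} (hf : f ∈ potentialSpace m n)
    {x y : ℤ × ℤ} (h : N.current f x y ≠ 0) : supNorm x ≤ n ∧ supNorm y ≤ n := by
  have hadj := N.adj_of_conductance_ne_zero (left_ne_zero_of_mul h)
  have h1 := supNorm_le_of_adj hadj
  have h2 := supNorm_le_of_adj hadj.symm
  by_contra hcon
  apply h
  rw [current, hf.2 x (by omega), hf.2 y (by omega)]
  simp

/-- Zero energy forces zero current on every edge; then `f` and `-f` are both subharmonic and vanish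
on the boundary, and the maximum principle applies. This definiteness is what produces Green
functions. -/
theorem eq_zero_of_dirichlet_self {f : ℤ × ℤ → ℝ} (hf : f ∈ potentialSpace m n)
    (h : N.dirichlet (boxFinset n) f f = 0) : f = 0 := by
  have hnn : ∀ x y, 0 ≤ N.conductance x y * (f x - f y) * (f x - f y) := fun x y => by
    rw [mul_assoc]
    exact mul_nonneg (N.conductance_nonneg x y) (mul_self_nonneg _)
  rw [dirichlet_apply, mul_eq_zero, or_iff_right (by norm_num),
    Finset.sum_eq_zero_iff_of_nonneg fun x _ => Finset.sum_nonneg fun y _ => hnn x y] at h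
  have hcur : ∀ x y, N.conductance x y * (f y - f x) = 0 := by
    intro x y
    by_contra hne
    have hne' : N.current f x y ≠ 0 := by
      contrapose! hne
      unfold current at hne
      linarith
    obtain ⟨hx, hy⟩ := N.supNorm_le_of_current_ne_zero hf hne'
    have h1 := (Finset.sum_eq_zero_iff_of_nonneg fun y _ => hnn x y).1
      (h x (mem_boxFinset.2 hx)) y (mem_boxFinset.2 hy)
    rcases mul_eq_zero.1 h1 with h2 | h2
    · exact hne' h2
    · exact right_ne_zero_of_mul hne' h2
  have key : ∀ g : ℤ × ℤ → ℝ, (∀ x, n ≤ supNorm x → g x = 0) →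
      (∀ x y, N.conductance x y * (g y - g x) = 0) → ∀ x, g x ≤ 0 := by
    intro g hg hg' x
    by_cases hx : n ≤ supNorm x
    · exact (hg x hx).le
    refine le_of_subharmonic (U := boxFinset (n - 1)) (F := boxFinset n) (c := N.conductance)
      N.conductance_nonneg (fun x => N.conductance_pos (adj_right x)) ?_ ?_ ?_ x
      (mem_boxFinset.2 (by omega))
    · intro x hx
      have := supNorm_le_of_adj (adj_right x)
      rw [mem_boxFinset] at *
      omega
    · intro x _
      simp [hg']
    · intro x _ y _
      by_cases hy : n ≤ supNorm y
      · exact Or.inr (hg y hy).le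
      · exact Or.inl (mem_boxFinset.2 (by omega))
  funext x
  refine le_antisymm (key f hf.2 hcur x) ?_
  have := key (-f) (fun x hx => by simp [hf.2 x hx]) (fun x y => by
    have := hcur x y
    simp only [Pi.neg_apply]
    linarith) x
  simpa using this

/-- `f` is the Green function of the vertex `v` in the box `B(n)` with `B(m)` identified to a single
vertex and with the boundary of `B(n)` grounded. The Green function of `B(m)` is that of `0`. -/
structure IsGreen (m n : ℤ) (v : ℤ × ℤ) (f : ℤ × ℤ → ℝ) : Prop where
  mem : f ∈ potentialSpace m n
  dirichlet_eq : ∀ g ∈ potentialSpace m n, N.dirichlet (boxFinset n) f g = g v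

/-- The Dirichlet form is definite on a finite-dimensional space, so it represents every linear
functional, in particular evaluation at `v`. -/
theorem exists_isGreen (m n : ℤ) (v : ℤ × ℤ) : ∃ f, N.IsGreen m n v f := by
  let V := potentialSpace m n
  let L : V →ₗ[ℝ] Module.Dual ℝ V :=
    ((N.dirichlet (boxFinset n)).domRestrict₁₂ V V)
  have hinj : Function.Injective L := by
    rw [← LinearMap.ker_eq_bot, LinearMap.ker_eq_bot']
    intro f hf
    have := congrArg (fun l => l f) hf
    exact Subtype.ext (N.eq_zero_of_dirichlet_self f.2 this)
  have hsurj := (LinearMap.injective_iff_surjective_of_finrank_eq_finrank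
    (Subspace.dual_finrank_eq (K := ℝ) (V := V)).symm).1 hinj
  obtain ⟨f, hf⟩ := hsurj ((LinearMap.proj v).domRestrict V)
  exact ⟨f, f.2, fun g hg => congrArg (fun l => l (⟨g, hg⟩ : V)) hf⟩

/-- Turns total net flows into Dirichlet pairings, which `IsGreen` evaluates as soon as the
indicator lies in `potentialSpace`. -/
theorem finsum_netOut_current {f : ℤ × ℤ → ℝ} (hf : f ∈ potentialSpace m n) (W : Set (ℤ × ℤ)) :
    ∑ᶠ x ∈ W, netOut (N.current f) x = N.dirichlet (boxFinset n) f (W.indicator 1) := by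
  have hcur : ∀ x y, N.current f x y ≠ 0 → x ∈ boxFinset n ∧ y ∈ boxFinset n := fun x y h => by
    rw [mem_boxFinset, mem_boxFinset]
    exact N.supNorm_le_of_current_ne_zero hf h
  rw [N.dirichlet_eq_sum_netOut _ f _ fun x y h => (hcur x y h).2, finsum_mem_def,
    finsum_eq_sum_of_support_subset (s := boxFinset n)]
  · refine Finset.sum_congr rfl fun x _ => ?_
    by_cases hx : x ∈ W <;> simp [hx]
  · intro x hx
    rw [Function.mem_support, Set.indicator_apply_ne_zero] at hx
    by_contra hxF
    apply hx.2
    rw [netOut_eq_sum (F := ∅) x, Finset.sum_empty]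
    intro y hy
    exact absurd (hcur x y hy).1 hxF

theorem netOut_current {f : ℤ × ℤ → ℝ} (hf : f ∈ potentialSpace m n) (x : ℤ × ℤ) :
    netOut (N.current f) x = N.dirichlet (boxFinset n) f (Set.indicator {x} 1) := by
  rw [← N.finsum_netOut_current hf, finsum_mem_singleton]

theorem netOut_current_eq_zero {f : ℤ × ℤ → ℝ} (hf : f ∈ potentialSpace m n) {x : ℤ × ℤ}
    (hx : supNorm x < m ∨ n < supNorm x) : netOut (N.current f) x = 0 := by
  rw [netOut_eq_sum (F := ∅) x, Finset.sum_empty]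
  intro y hy
  exfalso
  have hadj := N.adj_of_conductance_ne_zero (left_ne_zero_of_mul hy)
  have h1 := supNorm_le_of_adj hadj
  rcases hx with hx | hx
  · apply hy
    rw [current, hf.1 x hx.le, hf.1 y (by omega), sub_self, mul_zero]
  · have := N.supNorm_le_of_current_ne_zero hf hy
    omega

theorem indicator_singleton_mem {x : ℤ × ℤ} (h1 : m < supNorm x) (h2 : supNorm x < n)
    (hm : 0 ≤ m) : Set.indicator {x} 1 ∈ potentialSpace m n := by
  have hz := supNorm_zero
  refine ⟨fun y hy => ?_, fun y hy => ?_⟩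
  · rw [Set.indicator_of_notMem, Set.indicator_of_notMem]
    · rintro rfl; omega
    · rintro rfl; omega
  · rw [Set.indicator_of_notMem]
    rintro rfl; omega

theorem indicator_box_mem {k : ℤ} (hm : 0 ≤ m) (hmk : m ≤ k) (hkn : k < n) :
    (box k).indicator 1 ∈ potentialSpace m n := by
  have hz := supNorm_zero
  refine ⟨fun y hy => ?_, fun y hy => ?_⟩
  · rw [Set.indicator_of_mem, Set.indicator_of_mem]
    · rfl
    · rw [mem_box]; omega
    · rw [mem_box]; omega
  · rw [Set.indicator_of_notMem]
    rw [mem_box]; omega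

/-- No current leaves a vertex strictly inside B(m), since `f` is constant on the box; so ∂B(m) may
be replaced by B(m), whose indicator is admissible. -/
theorem dirichlet_inner {f : ℤ × ℤ → ℝ} (hf : f ∈ potentialSpace m n) :
    ∑ᶠ x ∈ boxBoundary m, netOut (N.current f) x =
      N.dirichlet (boxFinset n) f ((box m).indicator 1) := by
  rw [← N.finsum_netOut_current hf, finsum_mem_def, finsum_mem_def]
  congr 1
  funext x
  rcases lt_trichotomy (supNorm x) m with h | h | h
  · rw [Set.indicator_of_notMem, Set.indicator_of_mem, N.netOut_current_eq_zero hf (Or.inl h)]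
    · exact h.le
    · exact h.ne
  · rw [Set.indicator_of_mem (show x ∈ boxBoundary m from h),
      Set.indicator_of_mem (show x ∈ box m from h.le)]
  · rw [Set.indicator_of_notMem, Set.indicator_of_notMem]
    · exact not_le.2 h
    · exact h.ne'

/-- The indicator of ∂B(n) is not admissible, but inside B(n) it is 1 minus that of B(n - 1), and
the constant drops out of gradients. -/
theorem dirichlet_outer {f : ℤ × ℤ → ℝ} (hf : f ∈ potentialSpace m n) :
    ∑ᶠ x ∈ boxBoundary n, netOut (N.current f) x =
      -N.dirichlet (boxFinset n) f ((box (n - 1)).indicator 1) := by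
  rw [N.finsum_netOut_current hf, dirichlet_apply, dirichlet_apply, ← mul_neg,
    ← Finset.sum_neg_distrib]
  congr 1
  refine Finset.sum_congr rfl fun x hx => ?_
  rw [← Finset.sum_neg_distrib]
  refine Finset.sum_congr rfl fun y hy => ?_
  have key : ∀ x, x ∈ boxFinset n →
      (boxBoundary n).indicator (1 : ℤ × ℤ → ℝ) x = 1 - (box (n - 1)).indicator 1 x := by
    intro x hx
    rw [mem_boxFinset] at hx
    by_cases h : supNorm x = n
    · rw [Set.indicator_of_mem (show x ∈ boxBoundary n from h), Set.indicator_of_notMem]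
      · simp
      · rw [mem_box]; omega
    · rw [Set.indicator_of_notMem (show x ∉ boxBoundary n from h), Set.indicator_of_mem]
      · simp
      · rw [mem_box]; omega
  rw [key x hx, key y hy]
  ring

/-- The current of a function of the potential space is a flow; it is a unit flow once the net
flows out of the vertices are right. -/
theorem isUnitFlow_current {f : ℤ × ℤ → ℝ} (hf : f ∈ potentialSpace m n)
    {S T U : Set (ℤ × ℤ)}
    (hnode : ∀ x, x ∉ S → x ∉ T → x ∉ U → netOut (N.current f) x = 0)
    (hS : ∑ᶠ x ∈ S, netOut (N.current f) x = 1)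
    (hT : ∑ᶠ x ∈ T, netOut (N.current f) x = -1)
    (hU : ∑ᶠ x ∈ U, netOut (N.current f) x = 0) :
    IsUnitFlow squareLattice S T U (N.current f) where
  antisymm := N.current_antisymm f
  eq_zero_of_not_adj x y h := by
    by_contra h'
    exact h (N.adj_of_conductance_ne_zero (left_ne_zero_of_mul h'))
  finite_support := by
    refine Set.Finite.subset (boxFinset n ×ˢ boxFinset n).finite_toSet ?_
    rintro ⟨x, y⟩ h
    have := N.supNorm_le_of_current_ne_zero hf h
    simpa [mem_boxFinset] using this
  node_law := hnode
  source := hS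
  sink := hT
  node_law_glued := hU

/-! ### Effective resistances as values of Green functions -/

/-- The effective resistance across an annulus is the value on the inner boundary of the Green
function of that boundary. -/
theorem effRes_boundary (hm : 0 ≤ m) (hmn : m < n) {a : ℤ × ℤ → ℝ}
    (hGa : N.IsGreen m n 0 a) : N.effRes (boxBoundary m) (boxBoundary n) ∅ = a 0 := by
  obtain ⟨ha, hDa⟩ := hGa
  have h0 : (0 : ℤ × ℤ) ∈ box m := by rw [mem_box, supNorm_zero]; exact hm
  have h0' : (0 : ℤ × ℤ) ∈ box (n - 1) := by rw [mem_box, supNorm_zero]; omega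
  have hflow : IsUnitFlow squareLattice (boxBoundary m) (boxBoundary n) ∅ (N.current a) := by
    refine N.isUnitFlow_current ha (fun x h1 h2 _ => ?_) ?_ ?_ (by simp)
    · by_cases h : supNorm x < m ∨ n < supNorm x
      · exact N.netOut_current_eq_zero ha h
      · rw [mem_boxBoundary] at h1 h2
        rw [N.netOut_current ha, hDa _ (indicator_singleton_mem (by omega) (by omega) hm),
          Set.indicator_of_notMem]
        rintro rfl
        rw [supNorm_zero] at *
        omega
    · rw [N.dirichlet_inner ha, hDa _ (indicator_box_mem hm le_rfl hmn), Set.indicator_of_mem h0]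
      rfl
    · rw [N.dirichlet_outer ha, hDa _ (indicator_box_mem hm (by omega) (by omega)),
        Set.indicator_of_mem h0']
      rfl
  rw [N.effRes_eq_of_current hflow (a := a 0) (b := 0) (d := 0), sub_zero]
  · exact fun x hx => ha.1 x (le_of_eq hx)
  · exact fun x hx => ha.2 x (ge_of_eq hx)
  · exact fun x hx => hx.elim
  · exact Set.disjoint_left.2 fun x hx hx' => hmn.ne (hx.symm.trans hx')
  · simp
  · simp

/-- The combination of effective resistances between `v` and the two boundaries of an annulus that
gives the Green function of the inner boundary at `v`. -/
theorem effRes_add_effRes_sub_effRes (hm : 0 ≤ m) (hmn : m < n) {v : ℤ × ℤ} (hv : m < supNorm v)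
    (hvn : supNorm v < n) {a h : ℤ × ℤ → ℝ} (hGa : N.IsGreen m n 0 a)
    (hGh : N.IsGreen m n v h) :
    N.effRes {v} (boxBoundary n) (boxBoundary m) + N.effRes (boxBoundary m) (boxBoundary n) ∅
      - N.effRes {v} (boxBoundary m) (boxBoundary n) = 2 * a v := by
  obtain ⟨ha, hDa⟩ := id hGa
  obtain ⟨hh, hDh⟩ := hGh
  have h0 : (0 : ℤ × ℤ) ∈ box m := by rw [mem_box, supNorm_zero]; exact hm
  have h0' : (0 : ℤ × ℤ) ∈ box (n - 1) := by rw [mem_box, supNorm_zero]; omega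
  have hvm : v ∉ box m := not_le.2 hv
  have hv' : v ∈ box (n - 1) := by rw [mem_box]; omega
  have hv0 : v ≠ 0 := by rintro rfl; exact hvm h0
  have hsv : Set.indicator {v} 1 ∈ potentialSpace m n := indicator_singleton_mem hv hvn hm
  have hsingle : ∀ x : ℤ × ℤ, m < supNorm x → x ≠ v →
      (Set.indicator {x} 1 : ℤ × ℤ → ℝ) v = 0 ∧ (Set.indicator {x} 1 : ℤ × ℤ → ℝ) 0 = 0 := by
    intro x hx hxv
    refine ⟨Set.indicator_of_notMem (fun h => hxv h.symm) _, Set.indicator_of_notMem ?_ _⟩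
    rintro rfl
    exact hx.not_ge h0
  have dA : Disjoint {v} (boxBoundary m) :=
    Set.disjoint_singleton_left.2 fun hx => hv.ne' hx
  have dZ : Disjoint {v} (boxBoundary n) :=
    Set.disjoint_singleton_left.2 fun hx => hvn.ne hx
  have dAZ : Disjoint (boxBoundary m) (boxBoundary n) :=
    Set.disjoint_left.2 fun x hx hx' => hmn.ne (hx.symm.trans hx')
  have mA : (box m).indicator 1 ∈ potentialSpace m n := indicator_box_mem hm le_rfl hmn
  have mZ : (box (n - 1)).indicator 1 ∈ potentialSpace m n :=
    indicator_box_mem hm (by omega) (by omega)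
  have hflow1 : IsUnitFlow squareLattice {v} (boxBoundary n) (boxBoundary m) (N.current h) := by
    refine N.isUnitFlow_current hh (fun x h1 h2 h3 => ?_) ?_ ?_ ?_
    · by_cases hx : supNorm x < m ∨ n < supNorm x
      · exact N.netOut_current_eq_zero hh hx
      · rw [mem_boxBoundary] at h2 h3
        rw [N.netOut_current hh, hDh _ (indicator_singleton_mem (by omega) (by omega) hm),
          (hsingle x (by omega) h1).1]
    · rw [N.finsum_netOut_current hh, hDh _ hsv]
      simp
    · rw [N.dirichlet_outer hh, hDh _ mZ, Set.indicator_of_mem hv']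
      rfl
    · rw [N.dirichlet_inner hh, hDh _ mA, Set.indicator_of_notMem hvm]
  -- In `h - a` the currents into the outer boundary cancel, leaving a unit current from `v` to the
  -- inner boundary.
  have hf : h - a ∈ potentialSpace m n := Submodule.sub_mem _ hh ha
  have hDf : ∀ g ∈ potentialSpace m n, N.dirichlet (boxFinset n) (h - a) g = g v - g 0 := by
    intro g hg
    rw [map_sub, LinearMap.sub_apply, hDh g hg, hDa g hg]
  have hflow2 : IsUnitFlow squareLattice {v} (boxBoundary m) (boxBoundary n)
      (N.current (h - a)) := by
    refine N.isUnitFlow_current hf (fun x h1 h2 h3 => ?_) ?_ ?_ ?_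
    · by_cases hx : supNorm x < m ∨ n < supNorm x
      · exact N.netOut_current_eq_zero hf hx
      · rw [mem_boxBoundary] at h2 h3
        rw [N.netOut_current hf, hDf _ (indicator_singleton_mem (by omega) (by omega) hm),
          (hsingle x (by omega) h1).1, (hsingle x (by omega) h1).2, sub_zero]
    · rw [N.finsum_netOut_current hf, hDf _ hsv]
      simp [Ne.symm hv0]
    · rw [N.dirichlet_inner hf, hDf _ mA, Set.indicator_of_notMem hvm, Set.indicator_of_mem h0]
      simp
    · rw [N.dirichlet_outer hf, hDf _ mZ, Set.indicator_of_mem hv', Set.indicator_of_mem h0']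
      simp
  rw [N.effRes_boundary hm hmn hGa,
    N.effRes_eq_of_current hflow1 (a := h v) (b := 0) (d := h 0),
    N.effRes_eq_of_current hflow2 (a := h v - a v) (b := h 0 - a 0) (d := 0)]
  · have e1 := hDh a ha
    have e2 := hDa h hh
    rw [N.dirichlet_comm] at e1
    linarith
  · rintro x rfl; rfl
  · intro x hx
    simp [hh.1 x (le_of_eq hx), ha.1 x (le_of_eq hx)]
  · intro x hx
    simp [hh.2 x (ge_of_eq hx), ha.2 x (ge_of_eq hx)]
  · exact dA
  · exact dZ
  · exact dAZ
  · rintro x rfl; rfl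
  · exact fun x hx => hh.2 x (ge_of_eq hx)
  · exact fun x hx => hh.1 x (le_of_eq hx)
  · exact dZ
  · exact dA
  · exact dAZ.symm

end Network

/-! ### Logarithmic energy estimate and comparison on ∂B(k) -/

/-- Discrete Picone inequality: the defect is (bs - at)²/(ab). It handles the edges where the cutoff
varies. -/
theorem sub_mul_sq_div_sub_le {a b s t : ℝ} (ha : 0 < a) (hb : 0 < b) :
    (a - b) * (s ^ 2 / a - t ^ 2 / b) ≤ (s - t) ^ 2 := by
  have : (s - t) ^ 2 - (a - b) * (s ^ 2 / a - t ^ 2 / b) = (b * s - a * t) ^ 2 / (a * b) := by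
    field_simp
    ring
  have h : 0 ≤ (b * s - a * t) ^ 2 / (a * b) := by positivity
  linarith

/-- With u = log(a/b) the left side is 2 - e^u - e^{-u} = -4 sinh²(u/2), and |sinh x| ≥ |x|. It
handles the edges where the cutoff is 1. -/
theorem sub_mul_inv_sub_inv_le {a b : ℝ} (ha : 0 < a) (hb : 0 < b) :
    (a - b) * (1 / a - 1 / b) ≤ -(Real.log a - Real.log b) ^ 2 := by
  have hp : Real.exp ((Real.log a - Real.log b) / 2) * Real.exp ((Real.log a - Real.log b) / 2)
      = a / b := by
    rw [← Real.exp_add, add_halves, Real.exp_sub, Real.exp_log ha, Real.exp_log hb]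
  have hn : Real.exp (-((Real.log a - Real.log b) / 2)) *
      Real.exp (-((Real.log a - Real.log b) / 2)) = b / a := by
    rw [← Real.exp_add, ← neg_add, add_halves, neg_sub, Real.exp_sub, Real.exp_log ha,
      Real.exp_log hb]
  have hpn : Real.exp ((Real.log a - Real.log b) / 2) *
      Real.exp (-((Real.log a - Real.log b) / 2)) = 1 := by
    rw [← Real.exp_add, add_neg_cancel, Real.exp_zero]
  have hsinh : ((Real.log a - Real.log b) / 2) ^ 2 ≤
      Real.sinh ((Real.log a - Real.log b) / 2) ^ 2 := by
    rw [sq_le_sq, Real.abs_sinh]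
    exact Real.self_le_sinh_iff.2 (abs_nonneg _)
  rw [Real.sinh_eq] at hsinh
  have e : (a - b) * (1 / a - 1 / b) = 2 - a / b - b / a := by field_simp; ring
  rw [e, ← hp, ← hn]
  nlinarith

namespace Network

variable {N : Network squareLattice} {m n k : ℤ} {a η : ℤ × ℤ → ℝ}

theorem sum_conductance_eq_neg_netOut {f : ℤ × ℤ → ℝ} (hf : f ∈ potentialSpace m n) (x : ℤ × ℤ) :
    ∑ y ∈ boxFinset n, N.conductance x y * (f y - f x) = -netOut (N.current f) x := by
  rw [netOut_eq_sum (F := boxFinset n) x fun y hy =>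
    mem_boxFinset.2 (N.supNorm_le_of_current_ne_zero hf hy).2, ← Finset.sum_neg_distrib]
  refine Finset.sum_congr rfl fun y _ => ?_
  rw [current]; ring

/-- The maximum principle in an annulus. -/
theorem le_of_subharmonic_annulus {f : ℤ × ℤ → ℝ} {b : ℝ}
    (hsub : ∀ x, m < supNorm x → supNorm x < n →
      0 ≤ ∑ y ∈ boxFinset n, N.conductance x y * (f y - f x))
    (h1 : ∀ x, supNorm x = m → f x ≤ b) (h2 : ∀ x, supNorm x = n → f x ≤ b) {x : ℤ × ℤ}
    (hxm : m ≤ supNorm x) (hxn : supNorm x ≤ n) : f x ≤ b := by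
  by_cases hx1 : supNorm x = m
  · exact h1 x hx1
  by_cases hx2 : supNorm x = n
  · exact h2 x hx2
  have hmem : ∀ x, x ∈ boxFinset (n - 1) \ boxFinset m ↔ m < supNorm x ∧ supNorm x < n := by
    intro x
    rw [Finset.mem_sdiff, mem_boxFinset, mem_boxFinset]
    omega
  refine le_of_subharmonic (U := boxFinset (n - 1) \ boxFinset m) (F := boxFinset n)
    N.conductance_nonneg (fun x => N.conductance_pos (adj_right x)) ?_ ?_ ?_ x ?_
  · intro x hx
    have := supNorm_le_of_adj (adj_right x)
    rw [hmem] at hx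
    rw [mem_boxFinset]
    omega
  · intro x hx
    rw [hmem] at hx
    exact hsub x hx.1 hx.2
  · intro x hx y hxy
    have hadj := N.adj_of_conductance_ne_zero hxy
    have h3 := supNorm_le_of_adj hadj
    have h4 := supNorm_le_of_adj hadj.symm
    rw [hmem] at hx ⊢
    by_cases hy1 : supNorm y = m
    · exact Or.inr (h1 y hy1)
    by_cases hy2 : supNorm y = n
    · exact Or.inr (h2 y hy2)
    · exact Or.inl (by omega)
  · rw [hmem]; omega

namespace IsGreen

theorem harmonic (hG : N.IsGreen m n 0 a) (hm : 0 ≤ m) {x : ℤ × ℤ} (h1 : m < supNorm x)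
    (h2 : supNorm x < n) : ∑ y ∈ boxFinset n, N.conductance x y * (a y - a x) = 0 := by
  rw [sum_conductance_eq_neg_netOut hG.mem, N.netOut_current hG.mem,
    hG.dirichlet_eq _ (indicator_singleton_mem h1 h2 hm), Set.indicator_of_notMem, neg_zero]
  rintro rfl
  rw [supNorm_zero] at h1
  omega

theorem pos_zero (hG : N.IsGreen m n 0 a) (hm : 0 ≤ m) (hmn : m < n) : 0 < a 0 := by
  have h1 := hG.dirichlet_eq a hG.mem
  have hnn : 0 ≤ a 0 := by
    rw [← h1, dirichlet_apply]
    refine mul_nonneg (by norm_num) (Finset.sum_nonneg fun x _ => Finset.sum_nonneg fun y _ => ?_)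
    rw [mul_assoc]
    exact mul_nonneg (N.conductance_nonneg x y) (mul_self_nonneg _)
  refine lt_of_le_of_ne hnn fun h0 => ?_
  rw [← h0] at h1
  have h2 := hG.dirichlet_eq _ (indicator_box_mem hm le_rfl hmn)
  rw [N.eq_zero_of_dirichlet_self hG.mem h1, map_zero, LinearMap.zero_apply,
    Set.indicator_of_mem] at h2
  · simp at h2
  · rw [mem_box, supNorm_zero]; exact hm

theorem le_zero (hG : N.IsGreen m n 0 a) (hm : 0 ≤ m) (hmn : m < n) (x : ℤ × ℤ) : a x ≤ a 0 := by
  have h0 := hG.pos_zero hm hmn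
  by_cases hx1 : supNorm x ≤ m
  · exact (hG.mem.1 x hx1).le
  by_cases hx2 : n ≤ supNorm x
  · rw [hG.mem.2 x hx2]; exact h0.le
  refine le_of_subharmonic_annulus (fun _ h1 h2 => (hG.harmonic hm h1 h2).ge)
    (fun x hx => (hG.mem.1 x hx.le).le) (fun x hx => ?_) (le_of_not_ge hx1) (le_of_not_ge hx2)
  rw [hG.mem.2 x hx.ge]; exact h0.le

theorem nonneg (hG : N.IsGreen m n 0 a) (hm : 0 ≤ m) (hmn : m < n) (x : ℤ × ℤ) : 0 ≤ a x := by
  have h0 := hG.pos_zero hm hmn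
  by_cases hx1 : supNorm x ≤ m
  · rw [hG.mem.1 x hx1]; exact h0.le
  by_cases hx2 : n ≤ supNorm x
  · rw [hG.mem.2 x hx2]
  refine neg_nonpos.1 (le_of_subharmonic_annulus (N := N) (m := m) (n := n) (f := fun x => -a x)
    (fun x h1 h2 => ?_) (fun x hx => ?_) (fun x hx => ?_) (le_of_not_ge hx1) (le_of_not_ge hx2))
  · have h := hG.harmonic hm h1 h2
    rw [← neg_eq_zero, ← Finset.sum_neg_distrib] at h
    refine (Eq.trans (Finset.sum_congr rfl fun y _ => ?_) h).ge
    ring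
  · rw [hG.mem.1 x hx.le]; linarith
  · rw [hG.mem.2 x hx.ge, neg_zero]

theorem superharmonic (hG : N.IsGreen m n 0 a) (hm : 0 ≤ m) (hmn : m < n) {x : ℤ × ℤ}
    (h : supNorm x < n) : ∑ y ∈ boxFinset n, N.conductance x y * (a y - a x) ≤ 0 := by
  by_cases h1 : m < supNorm x
  · exact (hG.harmonic hm h1 h).le
  · refine Finset.sum_nonpos fun y _ => ?_
    refine mul_nonpos_of_nonneg_of_nonpos (N.conductance_nonneg x y) ?_
    rw [hG.mem.1 x (by omega)]
    linarith [hG.le_zero hm hmn y]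

/-- A logarithmic Caccioppoli inequality for the Green function. -/
theorem sum_log_sq_le (hG : N.IsGreen m n 0 a) (hm : 0 ≤ m) (hmn : m < n) (hmk : m ≤ k)
    (hη : η ∈ potentialSpace k n) (hη1 : ∀ x, supNorm x ≤ k → η x = 1) {ε : ℝ} (hε : 0 < ε) :
    1 / 2 * ∑ x ∈ boxFinset n, ∑ y ∈ boxFinset n, N.conductance x y *
      (if supNorm x ≤ k ∧ supNorm y ≤ k then
        (Real.log (a x + ε) - Real.log (a y + ε)) ^ 2 else 0) ≤
      N.dirichlet (boxFinset n) η η := by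
  have hu : ∀ x, 0 < a x + ε := fun x => by linarith [hG.nonneg hm hmn x]
  -- The test function of the Caccioppoli argument; ε is there because `a` vanishes on the outer
  -- boundary.
  have hg : (fun x => η x ^ 2 / (a x + ε)) ∈ potentialSpace m n := by
    refine ⟨fun x hx => ?_, fun x hx => ?_⟩
    · simp only
      rw [hG.mem.1 x hx, hη.1 x (hx.trans hmk)]
    · simp [hη.2 x hx]
  have h0 := hG.dirichlet_eq _ hg
  have h1 : 0 ≤ N.dirichlet (boxFinset n) a (fun x => η x ^ 2 / (a x + ε)) := by
    rw [h0]
    exact div_nonneg (sq_nonneg _) (hu 0).le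
  have h2 : 1 / 2 * ∑ x ∈ boxFinset n, ∑ y ∈ boxFinset n, (N.conductance x y *
      (if supNorm x ≤ k ∧ supNorm y ≤ k then
        (Real.log (a x + ε) - Real.log (a y + ε)) ^ 2 else 0)
      + N.conductance x y * (a x - a y) * (η x ^ 2 / (a x + ε) - η y ^ 2 / (a y + ε)))
      ≤ N.dirichlet (boxFinset n) η η := by
    rw [dirichlet_apply]
    refine mul_le_mul_of_nonneg_left (Finset.sum_le_sum fun x _ => Finset.sum_le_sum fun y _ => ?_)
      (by norm_num)
    rw [mul_assoc, mul_assoc, ← mul_add]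
    refine mul_le_mul_of_nonneg_left ?_ (N.conductance_nonneg x y)
    split_ifs with h
    · rw [hη1 x h.1, hη1 y h.2]
      have := sub_mul_inv_sub_inv_le (hu x) (hu y)
      rw [add_sub_add_right_eq_sub] at this
      rw [one_pow]
      linarith
    · have := sub_mul_sq_div_sub_le (s := η x) (t := η y) (hu x) (hu y)
      rw [add_sub_add_right_eq_sub] at this
      linarith
  simp only [Finset.sum_add_distrib, mul_add] at h2
  rw [dirichlet_apply] at h1
  linarith

/-- Some point of `∂B(k)` has at least the potential that a unit current from `∂B(k)` to `∂B(n)`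
creates on `∂B(k)`. -/
theorem exists_boundary_ge (hG : N.IsGreen m n 0 a) (hm : 0 ≤ m) (hmk : m ≤ k) (hkn : k < n)
    (hη : N.IsGreen k n 0 η) : ∃ x, supNorm x = k ∧ η 0 ≤ a x := by
  have hk := hm.trans hmk
  have hne : ((boxFinset k).filter fun x => supNorm x = k).Nonempty :=
    ⟨(k, 0), Finset.mem_filter.2 (by simp [mem_boxFinset, supNorm, abs_of_nonneg hk, hk])⟩
  obtain ⟨x₀, hx₀, hmax⟩ := Finset.exists_max_image _ a hne
  rw [Finset.mem_filter] at hx₀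
  refine ⟨x₀, hx₀.2, ?_⟩
  have hmax' : ∀ x, supNorm x = k → a x ≤ a x₀ := fun x hx =>
    hmax x (Finset.mem_filter.2 ⟨mem_boxFinset.2 hx.le, hx⟩)
  -- Flattening `a` on B(k) to its maximum over ∂B(k) makes it admissible for `η`. Only edges
  -- leaving B(k) change their pairing with `η`; `η` does not increase outward along them, so the
  -- pairing cannot drop from `η 0`.
  let b : ℤ × ℤ → ℝ := fun x => if supNorm x ≤ k then a x₀ else a x
  have hb : b ∈ potentialSpace k n := by
    refine ⟨fun x hx => ?_, fun x hx => ?_⟩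
    · simp only [b]
      rw [if_pos hx, if_pos (by rw [supNorm_zero]; exact hk)]
    · simp only [b]
      rw [if_neg (by omega), hG.mem.2 x hx]
  have e1 : N.dirichlet (boxFinset n) η b = a x₀ := by
    rw [hη.dirichlet_eq b hb]
    simp only [b]
    rw [if_pos (by rw [supNorm_zero]; exact hk)]
  have e2 : N.dirichlet (boxFinset n) η a = η 0 := by
    rw [dirichlet_comm]
    refine hG.dirichlet_eq η ⟨fun x hx => hη.mem.1 x (hx.trans hmk), hη.mem.2⟩
  rw [← e1, ← e2, dirichlet_apply, dirichlet_apply]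
  refine mul_le_mul_of_nonneg_left (Finset.sum_le_sum fun x _ => Finset.sum_le_sum fun y _ => ?_)
    (by norm_num)
  by_cases hxy : squareLattice.Adj x y
  swap
  · simp [conductance, hxy]
  have hx1 := supNorm_le_of_adj hxy
  have hy1 := supNorm_le_of_adj hxy.symm
  rw [mul_assoc, mul_assoc]
  refine mul_le_mul_of_nonneg_left ?_ (N.conductance_nonneg x y)
  have hle := hη.le_zero hk hkn
  by_cases hx : supNorm x ≤ k <;> by_cases hy : supNorm y ≤ k
  · simp [hη.mem.1 x hx, hη.mem.1 y hy]
  · simp only [b, if_pos hx, if_neg hy]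
    have h1 := hmax' x (by omega)
    have h2 := hle y
    rw [hη.mem.1 x hx]
    nlinarith
  · simp only [b, if_neg hx, if_pos hy]
    have h1 := hmax' y (by omega)
    have h2 := hle x
    rw [hη.mem.1 y hy]
    nlinarith
  · simp only [b, if_neg hx, if_neg hy]
    exact le_rfl

end IsGreen

end Network

/-! ### Winding numbers of lattice walks -/

/-- The signed crossing of the half-line `{(t, b + 1/2) : t > a + 1/2}`, where `p = (a, b)`, by the
lattice step from `x` to `y`. -/
def halfLineCrossing (p x y : ℤ × ℤ) : ℤ :=
  if p.1 < x.1 ∧ y.1 = x.1 ∧ x.2 = p.2 ∧ y.2 = p.2 + 1 then 1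
  else if p.1 < x.1 ∧ y.1 = x.1 ∧ x.2 = p.2 + 1 ∧ y.2 = p.2 then -1
  else 0

/-- The winding number, around the point `(a + 1/2, b + 1/2)`, where `p = (a, b)`, of a closed
lattice walk. -/
def windingAt {u v : ℤ × ℤ} (w : squareLattice.Walk u v) (p : ℤ × ℤ) : ℤ :=
  (w.darts.map fun d => halfLineCrossing p d.fst d.snd).sum

theorem windingAt_zero {x : ℤ × ℤ} (w : squareLattice.Walk x x) :
    windingAt w 0 = windingNumber w := by
  unfold windingAt windingNumber halfLineCrossing rayCrossing
  simp

theorem squareLattice_adj_cases {x y : ℤ × ℤ} (h : squareLattice.Adj x y) :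
    (y.1 = x.1 ∧ (y.2 = x.2 + 1 ∨ y.2 = x.2 - 1)) ∨
      (y.2 = x.2 ∧ (y.1 = x.1 + 1 ∨ y.1 = x.1 - 1)) := by
  have h' : |x.1 - y.1| + |x.2 - y.2| = 1 := h
  rcases abs_cases (x.1 - y.1) with h1 | h1 <;> rcases abs_cases (x.2 - y.2) with h2 | h2 <;> omega

/-- If the crossing weights at `p` and `q` differ by the increments of a function, then the winding
numbers differ by its total increment. -/
theorem windingAt_eq_of_sub {u v : ℤ × ℤ} (w : squareLattice.Walk u v) (p q : ℤ × ℤ)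
    (f : ℤ × ℤ → ℤ)
    (h : ∀ x ∈ w.support, ∀ y ∈ w.support, squareLattice.Adj x y →
      halfLineCrossing p x y = halfLineCrossing q x y + (f y - f x)) :
    windingAt w p = windingAt w q + (f v - f u) := by
  induction w with
  | nil => simp [windingAt]
  | cons hadj w ih =>
    have ih' := ih fun x hx y hy => h x (by simp [hx]) y (by simp [hy])
    have h1 := h _ (by simp) _ (by simp) hadj
    simp only [windingAt, SimpleGraph.Walk.darts_cons, List.map_cons, List.sum_cons] at *
    rw [ih', h1]
    ring

section

variable {u : ℤ × ℤ} {w : squareLattice.Walk u u} {p : ℤ × ℤ}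

/-- The two half-lines differ only in crossing the edge from `p` upwards, which a walk avoiding `p`
does not use. -/
theorem windingAt_left (hp : p ∉ w.support) : windingAt w p = windingAt w (p.1 - 1, p.2) := by
  rw [windingAt_eq_of_sub w p (p.1 - 1, p.2) fun _ => 0]
  · simp
  intro x hx y hy _
  have hxp : ¬(x.1 = p.1 ∧ x.2 = p.2) := fun h => hp (Prod.ext h.1 h.2 ▸ hx)
  have hyp : ¬(y.1 = p.1 ∧ y.2 = p.2) := fun h => hp (Prod.ext h.1 h.2 ▸ hy)
  unfold halfLineCrossing
  split_ifs <;> omega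

/-- The half-lines bound the half-row to the right of `p`. A walk avoiding `p` enters and leaves it
only across them, so the crossings differ by increments of its indicator, up to sign. -/
theorem windingAt_down (hp : p ∉ w.support) : windingAt w p = windingAt w (p.1, p.2 - 1) := by
  rw [windingAt_eq_of_sub w p (p.1, p.2 - 1) fun z => if p.1 < z.1 ∧ z.2 = p.2 then -1 else 0]
  · simp
  intro x hx y hy hxy
  have hxp : ¬(x.1 = p.1 ∧ x.2 = p.2) := fun h => hp (Prod.ext h.1 h.2 ▸ hx)
  have hyp : ¬(y.1 = p.1 ∧ y.2 = p.2) := fun h => hp (Prod.ext h.1 h.2 ▸ hy)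
  have := squareLattice_adj_cases hxy
  unfold halfLineCrossing
  split_ifs <;> omega

theorem windingAt_eq_of_adj {q : ℤ × ℤ} (hp : p ∉ w.support) (hq : q ∉ w.support)
    (h : squareLattice.Adj p q) : windingAt w p = windingAt w q := by
  rcases squareLattice_adj_cases h with ⟨h1, h2 | h2⟩ | ⟨h1, h2 | h2⟩
  · rw [windingAt_down hq, h1, h2, add_sub_cancel_right]
  · rw [windingAt_down hp, ← h1, ← h2]
  · rw [windingAt_left hq, h1, h2, add_sub_cancel_right]
  · rw [windingAt_left hp, ← h1, ← h2]

theorem windingAt_eq_zero_of_forall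
    (h : ∀ x ∈ w.support, ∀ y ∈ w.support, halfLineCrossing p x y = 0) : windingAt w p = 0 := by
  have hz : (w.darts.map fun d => halfLineCrossing p d.fst d.snd) =
      w.darts.map fun _ => 0 :=
    List.map_congr_left fun d hd =>
      h _ (w.dart_fst_mem_support_of_mem_darts hd) _ (w.dart_snd_mem_support_of_mem_darts hd)
  rw [windingAt, hz]
  simp

/-- A closed walk in a box does not wind around points that are not inside the box. -/
theorem windingAt_eq_zero {n : ℤ} (hw : ∀ x ∈ w.support, supNorm x ≤ n) (hp : p ∉ w.support)
    (hpn : n ≤ supNorm p) : windingAt w p = 0 := by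
  simp only [supNorm_le] at hw
  have hcases : n ≤ p.1 ∨ n ≤ p.2 ∨ p.2 ≤ -n ∨ p.1 ≤ -n := by
    by_contra! hcon
    have : supNorm p ≤ n - 1 := supNorm_le.2 (by omega)
    omega
  rcases hcases with h | h | h | h
  · refine windingAt_eq_zero_of_forall fun x hx y hy => ?_
    have := hw x hx
    unfold halfLineCrossing
    split_ifs <;> omega
  · refine windingAt_eq_zero_of_forall fun x hx y hy => ?_
    have := hw x hx
    have := hw y hy
    unfold halfLineCrossing
    split_ifs <;> omega
  · rw [windingAt_down hp]
    refine windingAt_eq_zero_of_forall fun x hx y hy => ?_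
    have := hw x hx
    have := hw y hy
    unfold halfLineCrossing
    simp only
    split_ifs <;> omega
  -- To the left of the box the half-line cuts right through it, and crossings are increments of the
  -- indicator of the upper half-plane. The half-line at (n, 0) is never crossed.
  · rw [windingAt_left hp, windingAt_eq_of_sub w _ (n, 0) fun z => if p.2 < z.2 then 1 else 0]
    · rw [windingAt_eq_zero_of_forall]
      · simp
      · intro x hx y hy
        have := hw x hx
        unfold halfLineCrossing
        simp only
        split_ifs <;> omega
    · intro x hx y hy hxy
      have := hw x hx
      have := hw y hy
      have := squareLattice_adj_cases hxy
      unfold halfLineCrossing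
      simp only
      split_ifs <;> omega

/-- The winding number around the points of a box that is avoided by a closed walk. -/
theorem windingAt_eq_windingNumber {m : ℤ} (hw : ∀ x ∈ w.support, m < supNorm x)
    (hp : supNorm p ≤ m) : windingAt w p = windingNumber w := by
  have hnot : ∀ i j : ℤ, -m ≤ i → i ≤ m → -m ≤ j → j ≤ m → (i, j) ∉ w.support := by
    intro i j h1 h2 h3 h4 h
    have := hw _ h
    have : supNorm (i, j) ≤ m := supNorm_le.2 ⟨⟨h1, h2⟩, ⟨h3, h4⟩⟩
    omega
  have hstep : ∀ i j : ℤ, -m ≤ i → i + 1 ≤ m → -m ≤ j → j ≤ m →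
      windingAt w (i + 1, j) = windingAt w (i, j) := by
    intro i j h1 h2 h3 h4
    rw [windingAt_left (hnot _ _ (by omega) h2 h3 h4), add_sub_cancel_right]
  have hstep' : ∀ i j : ℤ, -m ≤ i → i ≤ m → -m ≤ j → j + 1 ≤ m →
      windingAt w (i, j + 1) = windingAt w (i, j) := by
    intro i j h1 h2 h3 h4
    rw [windingAt_down (hnot _ _ h1 h2 (by omega) h4), add_sub_cancel_right]
  have hrow : ∀ i j : ℤ, -m ≤ i → i ≤ m → -m ≤ j → j ≤ m →
      windingAt w (i, j) = windingAt w (0, j) := by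
    intro i j
    induction i using Int.induction_on with
    | zero => intros; rfl
    | succ i ih => intro h1 h2 h3 h4; rw [hstep _ _ (by omega) h2 h3 h4, ih] <;> omega
    | pred i ih =>
      intro h1 h2 h3 h4
      rw [← hstep _ _ h1 (by omega) h3 h4, sub_add_cancel, ih] <;> omega
  have hcol : ∀ j : ℤ, -m ≤ j → j ≤ m → windingAt w (0, j) = windingAt w 0 := by
    intro j
    induction j using Int.induction_on with
    | zero => intros; rfl
    | succ j ih => intro h1 h2; rw [hstep' _ _ (by omega) (by omega) (by omega) h2, ih] <;> omega
    | pred j ih =>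
      intro h1 h2
      rw [← hstep' _ _ (by omega) (by omega) h1 (by omega), sub_add_cancel, ih] <;> omega
  obtain ⟨⟨h1, h2⟩, h3, h4⟩ := supNorm_le.1 hp
  rw [← windingAt_zero, ← hcol p.2 h3 h4, ← hrow p.1 p.2 h1 h2 h3 h4]

/-! ### The Green function on contours -/

namespace Network.IsGreen

variable {N : Network squareLattice} {m n k l : ℤ} {a : ℤ × ℤ → ℝ}

/-- On a contour around the annulus `B(k) \ B(l)` the Green function is somewhere at most what it is
at a given point inside. -/
theorem exists_le_of_inside (hG : N.IsGreen m n 0 a) (hm : 0 ≤ m) (hkn : k < n)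
    (hmn : m < n) (hw : ∀ x ∈ w.support, supNorm x ≤ k ∧ l < supNorm x)
    (hw0 : windingNumber w ≠ 0) {v : ℤ × ℤ} (hv : supNorm v ≤ l) :
    ∃ y ∈ w.support, a y ≤ a v := by
  classical
  obtain ⟨y₀, hy₀, hmin⟩ := w.support.toFinset.exists_min_image a ⟨u, by simp⟩
  simp only [List.mem_toFinset] at hy₀ hmin
  refine ⟨y₀, hy₀, ?_⟩
  -- The points of nonzero winding number serve as the interior of the contour, without the Jordan
  -- curve theorem: they lie in B(k), and a neighbour of one is another or is on the contour.
  have hmem : ∀ x, x ∈ (boxFinset k).filter (fun x => x ∉ w.support ∧ windingAt w x ≠ 0) ↔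
      x ∉ w.support ∧ windingAt w x ≠ 0 := by
    intro x
    rw [Finset.mem_filter, mem_boxFinset, and_iff_right_of_imp]
    rintro ⟨h1, h2⟩
    by_contra h3
    exact h2 (windingAt_eq_zero (fun x hx => (hw x hx).1) h1 (by omega))
  have := le_of_subharmonic (f := -a) (b := -a y₀)
    (U := (boxFinset k).filter (fun x => x ∉ w.support ∧ windingAt w x ≠ 0)) (F := boxFinset n)
    N.conductance_nonneg (fun x => N.conductance_pos (adj_right x)) ?_ ?_ ?_ v ?_
  · simpa using this
  · intro x hx
    have h1 := supNorm_le_of_adj (adj_right x)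
    have h2 := mem_boxFinset.1 (Finset.mem_filter.1 hx).1
    rw [mem_boxFinset]
    omega
  · intro x hx
    have h2 := mem_boxFinset.1 (Finset.mem_filter.1 hx).1
    have h := hG.superharmonic hm hmn (h2.trans_lt hkn)
    have e : ∑ y ∈ boxFinset n, N.conductance x y * ((-a) y - (-a) x) =
        -∑ y ∈ boxFinset n, N.conductance x y * (a y - a x) := by
      rw [← Finset.sum_neg_distrib]
      refine Finset.sum_congr rfl fun y _ => ?_
      simp only [Pi.neg_apply]; ring
    rw [e]
    linarith
  · intro x hx y hxy
    rw [hmem] at hx ⊢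
    by_cases hy : y ∈ w.support
    · right
      have := hmin y hy
      simpa using this
    · left
      refine ⟨hy, ?_⟩
      rw [← windingAt_eq_of_adj hx.1 hy (N.adj_of_conductance_ne_zero hxy)]
      exact hx.2
  · rw [hmem]
    refine ⟨fun h => ?_, ?_⟩
    · have := (hw v h).2
      omega
    · rwa [windingAt_eq_windingNumber (fun x hx => (hw x hx).2) hv]

/-- On a contour around the annulus `B(k) \ B(l)` the Green function is somewhere at least what it
is at a given point of `∂B(k)`. -/
theorem exists_ge_of_outside (hG : N.IsGreen m n 0 a) (hm : 0 ≤ m) (hml : m ≤ l) (hmn : m < n)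
    (hkn : k < n)
    (hw : ∀ x ∈ w.support, supNorm x ≤ k ∧ l < supNorm x)
    (hw0 : windingNumber w ≠ 0) {v : ℤ × ℤ} (hv : supNorm v = k) :
    ∃ y ∈ w.support, a v ≤ a y := by
  classical
  by_cases hvw : v ∈ w.support
  · exact ⟨v, hvw, le_rfl⟩
  obtain ⟨y₀, hy₀, hmax⟩ := w.support.toFinset.exists_max_image a ⟨u, by simp⟩
  simp only [List.mem_toFinset] at hy₀ hmax
  refine ⟨y₀, hy₀, ?_⟩
  -- The exterior domain, of winding number 0, avoids B(l) and hence the source; it is bounded by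
  -- the contour and the outer boundary, where `a` vanishes.
  refine le_of_subharmonic (f := a) (b := a y₀)
    (U := (boxFinset (n - 1)).filter (fun x => x ∉ w.support ∧ windingAt w x = 0))
    (F := boxFinset n)
    N.conductance_nonneg (fun x => N.conductance_pos (adj_right x)) ?_ ?_ ?_ v ?_
  · intro x hx
    have h1 := supNorm_le_of_adj (adj_right x)
    have h2 := mem_boxFinset.1 (Finset.mem_filter.1 hx).1
    rw [mem_boxFinset]
    omega
  · intro x hx
    rw [Finset.mem_filter, mem_boxFinset] at hx
    refine (hG.harmonic hm ?_ (by omega)).ge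
    by_contra h
    apply hw0
    rw [← windingAt_eq_windingNumber (fun x hx => (hw x hx).2) (show supNorm x ≤ l by omega)]
    exact hx.2.2
  · intro x hx y hxy
    rw [Finset.mem_filter] at hx ⊢
    by_cases hy : y ∈ w.support
    · exact Or.inr (hmax y hy)
    by_cases hyn : n ≤ supNorm y
    · right
      rw [hG.mem.2 y hyn]
      exact hG.nonneg hm hmn y₀
    · left
      rw [mem_boxFinset]
      refine ⟨by omega, hy, ?_⟩
      rw [← windingAt_eq_of_adj hx.2.1 hy (N.adj_of_conductance_ne_zero hxy)]
      exact hx.2.2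
  · rw [Finset.mem_filter, mem_boxFinset]
    exact ⟨by omega, hvw, windingAt_eq_zero (fun x hx => (hw x hx).1) hvw hv.ge⟩

end Network.IsGreen

end

/-! ### Length and resistance; the Harnack inequality -/

/-- The oscillation of a function along an edge. -/
def edgeOsc {V : Type*} (f : V → ℝ) : Sym2 V → ℝ :=
  Sym2.lift ⟨fun x y => |f x - f y|, fun _ _ => abs_sub_comm _ _⟩

theorem edgeOsc_mk {V : Type*} (f : V → ℝ) (x y : V) : edgeOsc f s(x, y) = |f x - f y| := rfl

theorem abs_sub_le_sum_edgeOsc {V : Type*} {G : SimpleGraph V} (f : V → ℝ) {u v : V}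
    (w : G.Walk u v) {y z : V} (hy : y ∈ w.support) (hz : z ∈ w.support) :
    |f y - f z| ≤ (w.edges.map (edgeOsc f)).sum := by
  induction w generalizing y z with
  | nil =>
    simp only [SimpleGraph.Walk.support_nil, List.mem_singleton] at hy hz
    simp [hy, hz]
  | @cons a b c hadj w ih =>
    have hb : b ∈ w.support := w.start_mem_support
    rw [SimpleGraph.Walk.edges_cons, List.map_cons, List.sum_cons, edgeOsc_mk]
    rw [SimpleGraph.Walk.support_cons, List.mem_cons] at hy hz
    rcases hy with rfl | hy <;> rcases hz with rfl | hz
    · rw [sub_self, abs_zero]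
      have := ih hb hb
      rw [sub_self, abs_zero] at this
      positivity
    · linarith [abs_sub_le (f y) (f b) (f z), ih hb hz]
    · linarith [abs_sub_le (f y) (f b) (f z), ih hy hb, abs_sub_comm (f z) (f b)]
    · linarith [ih hy hz, abs_nonneg (f a - f b)]

/-- Each edge that is not a loop comes from two ordered pairs. This passes from sums over edges to
the double sums of the Dirichlet form. -/
theorem two_mul_sum_edges_le {V : Type*} [DecidableEq V] (F : Finset V) (E : Finset (Sym2 V))
    (φ : Sym2 V → ℝ) (hφ : ∀ e, 0 ≤ φ e) (hdiag : ∀ e ∈ E, ¬e.IsDiag)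
    (hEF : ∀ x y, s(x, y) ∈ E → x ∈ F) :
    2 * ∑ e ∈ E, φ e ≤ ∑ x ∈ F, ∑ y ∈ F, if s(x, y) ∈ E then φ s(x, y) else 0 := by
  rw [← Finset.sum_product', ← Finset.sum_filter (s := F ×ˢ F) (fun p => s(p.1, p.2) ∈ E)
    (fun p => φ s(p.1, p.2)), ← Finset.sum_fiberwise_of_maps_to (t := E)
    (g := fun p : V × V => s(p.1, p.2)) (fun p hp => (Finset.mem_filter.1 hp).2), Finset.mul_sum]
  refine Finset.sum_le_sum fun e he => ?_
  induction e using Sym2.ind with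
  | _ x y =>
    have hxy : x ≠ y := fun h => hdiag _ he (Sym2.mk_isDiag_iff.2 h)
    have hx := hEF x y he
    have hy := hEF y x (Sym2.eq_swap ▸ he)
    have hsub : ({(x, y), (y, x)} : Finset (V × V)) ⊆
        ((F ×ˢ F).filter fun p => s(p.1, p.2) ∈ E).filter fun p => s(p.1, p.2) = s(x, y) := by
      intro p hp
      rw [Finset.mem_insert, Finset.mem_singleton] at hp
      rcases hp with rfl | rfl
      · simp [hx, hy, he]
      · simp [hx, hy, he, Sym2.eq_swap (a := y) (b := x)]
    refine le_trans (le_of_eq ?_) (Finset.sum_le_sum_of_subset_of_nonneg hsub fun p _ _ => hφ _)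
    rw [Finset.sum_pair (by simp [hxy])]
    simp only [Sym2.eq_swap (a := y) (b := x)]
    ring

namespace Network

/-- The easy half of the duality between resistance and length for a family of edge sets. -/
theorem sq_le_mul_familyRes {V : Type*} [DecidableEq V] {G : SimpleGraph V} (N : Network G)
    {F : Set (Finset (Sym2 V))} (d : Sym2 V → ℝ) {l E : ℝ} (hl : 0 < l) (hE : 0 < E)
    (hedge : ∀ P ∈ F, ∀ e ∈ P, e ∈ G.edgeSet) (hlen : ∀ P ∈ F, l ≤ ∑ e ∈ P, d e)
    (henergy : ∀ I : Finset (Finset (Sym2 V)), (∀ P ∈ I, P ∈ F) →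
      ∑ e ∈ I.biUnion id, d e ^ 2 * (1 / N.res e) ≤ E)
    (hpos : 0 < N.familyRes F) : l ^ 2 ≤ E * N.familyRes F := by
  rw [← div_le_iff₀' hE]
  refine le_csInf ?_ ?_
  · by_contra hne
    rw [Set.not_nonempty_iff_eq_empty] at hne
    unfold familyRes at hpos
    rw [hne, Real.sInf_empty] at hpos
    exact lt_irrefl _ hpos
  rintro R ⟨I, ρ, hI, hIF, hρ, hρr, rfl⟩
  have hPne : ∀ P ∈ I, 0 < ∑ e ∈ P, ρ e P := by
    intro P hP
    refine Finset.sum_pos (fun e _ => hρ e P) ?_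
    rw [Finset.nonempty_iff_ne_empty]
    rintro rfl
    have := hlen _ (hIF _ hP)
    rw [Finset.sum_empty] at this
    linarith
  have hS : 0 < ∑ P ∈ I, (∑ e ∈ P, ρ e P)⁻¹ :=
    Finset.sum_pos (fun P hP => inv_pos.2 (hPne P hP)) hI
  rw [le_inv_comm₀ (by positivity) hS, inv_div, le_div_iff₀ (by positivity)]
  refine le_trans ?_ (henergy I hIF)
  -- Cauchy–Schwarz on each `P`: (∑ d)² ≤ (∑ ρ)(∑ d²/ρ). Summing over `P` and exchanging sums then
  -- brings in the constraint on `ρ`.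
  have h1 : ∀ P ∈ I, (∑ e ∈ P, ρ e P)⁻¹ * l ^ 2 ≤ ∑ e ∈ P, d e ^ 2 * (1 / ρ e P) := by
    intro P hP
    have hcs := Finset.sq_sum_div_le_sum_sq_div P d (g := fun e => ρ e P) fun e _ => hρ e P
    have hlP := hlen P (hIF P hP)
    simp only [mul_one_div]
    refine le_trans ?_ hcs
    rw [inv_mul_eq_div]
    have := (hPne P hP).le
    gcongr
  calc (∑ P ∈ I, (∑ e ∈ P, ρ e P)⁻¹) * l ^ 2
      = ∑ P ∈ I, (∑ e ∈ P, ρ e P)⁻¹ * l ^ 2 := Finset.sum_mul _ _ _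
    _ ≤ ∑ P ∈ I, ∑ e ∈ P, d e ^ 2 * (1 / ρ e P) := Finset.sum_le_sum h1
    _ = ∑ e ∈ I.biUnion id, ∑ P ∈ I with e ∈ P, d e ^ 2 * (1 / ρ e P) := by
        refine Finset.sum_comm' fun P e => ?_
        simp only [Finset.mem_filter, Finset.mem_biUnion, id]
        exact ⟨fun h => ⟨⟨h.1, h.2⟩, P, h.1, h.2⟩, fun h => h.1⟩
    _ ≤ ∑ e ∈ I.biUnion id, d e ^ 2 * (1 / N.res e) := by
        refine Finset.sum_le_sum fun e he => ?_
        rw [← Finset.mul_sum]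
        obtain ⟨P, hP, heP⟩ := Finset.mem_biUnion.1 he
        exact mul_le_mul_of_nonneg_left (hρr e (hedge P (hIF P hP) e heP)) (sq_nonneg _)

namespace IsGreen

variable {N : Network squareLattice} {m n k l : ℤ} {a η : ℤ × ℤ → ℝ}

/-- A Harnack inequality: if the resistance around `B(k) \ B(l)` is positive, then it controls the
logarithm of the ratio of the resistance across `B(n) \ B(k)` and the Green function in `B(l)`. -/
theorem log_sq_mul_le (hG : N.IsGreen m n 0 a) (hη : N.IsGreen k n 0 η) (hm : 0 ≤ m)
    (hml : m ≤ l) (hlk : l < k) (hkn : k < n) {v : ℤ × ℤ} (hv : supNorm v ≤ l) {ε : ℝ}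
    (hε : 0 < ε) (hlt : a v < η 0) (hpos : 0 < N.resAround l k) :
    (Real.log (η 0 + ε) - Real.log (a v + ε)) ^ 2 * η 0 ≤ N.resAround l k := by
  have hmk : m ≤ k := by omega
  have hmn : m < n := by omega
  have hη0 := hη.pos_zero (hm.trans hmk) hkn
  have hav := hG.nonneg hm hmn v
  have hlog : 0 < Real.log (η 0 + ε) - Real.log (a v + ε) :=
    sub_pos.2 (Real.log_lt_log (by linarith) (by linarith))
  obtain ⟨x₀, hx₀, hηx₀⟩ := hG.exists_boundary_ge hm hmk hkn hη
  set f : ℤ × ℤ → ℝ := fun x => Real.log (a x + ε) with hf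
  -- The cutoff `η / η 0` equals 1 on B(k) and has energy `1 / η 0`.
  have hη' : (1 / η 0) • η ∈ potentialSpace k n := Submodule.smul_mem _ _ hη.mem
  have hcacc := hG.sum_log_sq_le hm hmn hmk hη' (fun x hx => by
    rw [Pi.smul_apply, hη.mem.1 x hx, smul_eq_mul, one_div_mul_cancel hη0.ne']) hε
  rw [map_smul, map_smul, LinearMap.smul_apply, hη.dirichlet_eq _ hη.mem, smul_eq_mul,
    smul_eq_mul, one_div_mul_cancel hη0.ne', mul_one] at hcacc
  have hfin := N.sq_le_mul_familyRes (F := contours l k) (edgeOsc f) hlog (one_div_pos.2 hη0)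
    ?_ ?_ ?_ hpos
  · rw [one_div_mul_eq_div, le_div_iff₀ hη0] at hfin
    exact hfin
  · rintro P ⟨x, w, hw, _, _, rfl⟩ e he
    exact w.edges_subset_edgeSet (List.mem_toFinset.1 he)
  · rintro P ⟨x, w, hw, hsupp, hwind, rfl⟩
    have hsupp' : ∀ y ∈ w.support, supNorm y ≤ k ∧ l < supNorm y := fun y hy =>
      ⟨(hsupp y hy).1, not_le.1 (hsupp y hy).2⟩
    obtain ⟨y, hy, hya⟩ := hG.exists_le_of_inside hm hkn hmn hsupp' hwind hv
    obtain ⟨z, hz, hza⟩ := hG.exists_ge_of_outside hm hml hmn hkn hsupp' hwind hx₀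
    rw [List.sum_toFinset _ hw.edges_nodup]
    refine le_trans ?_ (abs_sub_le_sum_edgeOsc f w hz hy)
    refine le_trans ?_ (le_abs_self _)
    have hy0 := hG.nonneg hm hmn y
    exact sub_le_sub (Real.log_le_log (by linarith) (by linarith))
      (Real.log_le_log (by linarith) (by linarith))
  · intro I hI
    have hE : ∀ e ∈ I.biUnion id, e ∈ squareLattice.edgeSet ∧ ∀ x ∈ e, supNorm x ≤ k := by
      intro e he
      obtain ⟨P, hP, heP⟩ := Finset.mem_biUnion.1 he
      obtain ⟨x, w, hw, hsupp, hwind, rfl⟩ := hI P hP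
      have he' := List.mem_toFinset.1 heP
      exact ⟨w.edges_subset_edgeSet he', fun x hx =>
        (hsupp x (w.mem_support_of_mem_edges he' hx)).1⟩
    -- The absolute value is needed because `res` is unconstrained off the edge set, whereas the
    -- weight must be nonnegative everywhere.
    have hedges := two_mul_sum_edges_le (boxFinset n) (I.biUnion id)
      (fun e => edgeOsc f e ^ 2 * |1 / N.res e|)
      (fun e => by positivity)
      (fun e he => squareLattice.not_isDiag_of_mem_edgeSet (hE e he).1)
      (fun x y hxy => mem_boxFinset.2 (((hE _ hxy).2 x (Sym2.mem_mk_left x y)).trans hkn.le))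
    refine le_trans ?_ hcacc
    have hle : ∑ e ∈ I.biUnion id, edgeOsc f e ^ 2 * (1 / N.res e) ≤
        ∑ e ∈ I.biUnion id, edgeOsc f e ^ 2 * |1 / N.res e| :=
      Finset.sum_le_sum fun e _ => mul_le_mul_of_nonneg_left (le_abs_self _) (sq_nonneg _)
    refine hle.trans ?_
    rw [one_div_mul_eq_div, le_div_iff₀' two_pos]
    refine hedges.trans (Finset.sum_le_sum fun x _ => Finset.sum_le_sum fun y _ => ?_)
    split_ifs with h1 h2 h2
    · have hadj : squareLattice.Adj x y := (hE _ h1).1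
      have hr := N.res_pos _ (hE _ h1).1
      rw [edgeOsc_mk, sq_abs, conductance, if_pos hadj, one_div, abs_of_pos (inv_pos.2 hr),
        mul_comm]
    · exact absurd ⟨(hE _ h1).2 x (Sym2.mem_mk_left x y), (hE _ h1).2 y (Sym2.mem_mk_right x y)⟩ h2
    · exact mul_nonneg (N.conductance_nonneg x y) (sq_nonneg _)
    · rw [mul_zero]

/-- A lower bound for the Green function in `B(l)` in terms of the resistance around the annulus
`B(k) \ B(l)`. -/
theorem resAround_le (hG : N.IsGreen m n 0 a) (hη : N.IsGreen k n 0 η) (hm : 0 ≤ m)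
    (hml : m ≤ l) (hlk : l < k) (hkn : k < n) {v : ℤ × ℤ} (hv : supNorm v ≤ l) {C : ℝ}
    (hC : 0 < C) (h : N.resAround l k ≤ C * η 0) :
    N.resAround l k ≤ C * Real.exp √C * a v := by
  have hav := hG.nonneg hm (by omega) v
  have hη0 := hη.pos_zero (hm.trans (hml.trans hlk.le)) hkn
  rcases le_or_gt (N.resAround l k) 0 with hR | hR
  · exact hR.trans (by positivity)
  suffices hs : η 0 ≤ Real.exp √C * a v by
    refine h.trans ?_
    rw [mul_assoc]
    exact mul_le_mul_of_nonneg_left hs hC.le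
  rcases le_or_gt (η 0) (a v) with hlt | hlt
  · exact hlt.trans (le_mul_of_one_le_left hav (Real.one_le_exp (Real.sqrt_nonneg C)))
  -- Only `0 ≤ a v` is available, so the logarithms are taken with ε > 0 and ε is removed
  -- afterwards.
  have key : ∀ ε > 0, η 0 ≤ Real.exp √C * a v + Real.exp √C * ε := by
    intro ε hε
    have h1 := hG.log_sq_mul_le hη hm hml hlk hkn hv hε hlt hR
    have h2 : (Real.log (η 0 + ε) - Real.log (a v + ε)) ^ 2 ≤ C :=
      le_of_mul_le_mul_right (h1.trans h) hη0
    have h3 := Real.le_sqrt_of_sq_le h2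
    rw [← Real.log_div (by linarith) (by linarith),
      Real.log_le_iff_le_exp (div_pos (by linarith) (by linarith)),
      div_le_iff₀ (by linarith)] at h3
    linarith
  refine le_of_forall_pos_le_add fun δ hδ => ?_
  have := key (δ / Real.exp √C) (by positivity)
  rwa [mul_div_cancel₀ _ (Real.exp_ne_zero _)] at this

end IsGreen

end Network

/-! ### Hitting probabilities of the random walk -/

namespace Network

section

variable {V : Type*} {G : SimpleGraph V} (N : Network G)

theorem transProb_nonneg (x y : V) : 0 ≤ N.transProb x y :=
  div_nonneg (N.conductance_nonneg x y) (finsum_nonneg fun z => N.conductance_nonneg x z)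

theorem sum_transProb_le_one (F : Finset V) (x : V) : ∑ y ∈ F, N.transProb x y ≤ 1 := by
  classical
  unfold transProb
  rw [← Finset.sum_div]
  by_cases h : (Function.support (N.conductance x)).Finite
  · refine div_le_one_of_le₀ ?_ (finsum_nonneg fun z => N.conductance_nonneg x z)
    rw [finsum_eq_sum_of_support_subset (s := F ∪ h.toFinset) _ fun z hz => by simp_all]
    exact Finset.sum_le_sum_of_subset_of_nonneg Finset.subset_union_left
      fun z _ _ => N.conductance_nonneg x z
  -- At a vertex of infinite degree the `finsum` defaults to 0, and so does the quotient.
  · rw [finsum_of_infinite_support h, div_zero]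
    exact zero_le_one

open Classical in
/-- The probability that the walk started at a given vertex hits `A` before `Z` within a given
number of steps without leaving `F`. -/
def hitProb (A Z : Set V) (F : Finset V) : ℕ → V → ℝ
  | 0 => A.indicator 1
  | n + 1 => fun x => if x ∈ A then 1 else if x ∈ Z then 0 else
      ∑ y ∈ F, N.transProb x y * hitProb A Z F n y

variable (A Z : Set V) (F : Finset V)

theorem hitProb_of_mem (n : ℕ) {x : V} (hx : x ∈ A) : N.hitProb A Z F n x = 1 := by
  cases n <;> simp [hitProb, hx]

theorem hitProb_of_mem_right (n : ℕ) {x : V} (hxA : x ∉ A) (hx : x ∈ Z) :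
    N.hitProb A Z F n x = 0 := by
  cases n <;> simp [hitProb, hxA, hx]

theorem hitProb_succ (n : ℕ) {x : V} (hxA : x ∉ A) (hx : x ∉ Z) :
    N.hitProb A Z F (n + 1) x = ∑ y ∈ F, N.transProb x y * N.hitProb A Z F n y := by
  simp [hitProb, hxA, hx]

theorem hitProb_nonneg (n : ℕ) (x : V) : 0 ≤ N.hitProb A Z F n x := by
  induction n generalizing x with
  | zero => exact Set.indicator_nonneg (fun _ _ => zero_le_one) _
  | succ n ih =>
    unfold hitProb
    split_ifs
    · exact zero_le_one
    · exact le_rfl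
    · exact Finset.sum_nonneg fun y _ => mul_nonneg (N.transProb_nonneg x y) (ih y)

theorem hitProb_le_one (n : ℕ) (x : V) : N.hitProb A Z F n x ≤ 1 := by
  induction n generalizing x with
  | zero => exact Set.indicator_le_self' (fun _ _ => zero_le_one) _
  | succ n ih =>
    unfold hitProb
    split_ifs
    · exact le_rfl
    · exact zero_le_one
    · refine le_trans (Finset.sum_le_sum fun y _ => ?_) (N.sum_transProb_le_one F x)
      exact mul_le_of_le_one_right (N.transProb_nonneg x y) (ih y)

theorem hitProb_le_succ (n : ℕ) (x : V) : N.hitProb A Z F n x ≤ N.hitProb A Z F (n + 1) x := by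
  induction n generalizing x with
  | zero =>
    by_cases hx : x ∈ A
    · rw [hitProb_of_mem _ _ _ _ _ hx, hitProb_of_mem _ _ _ _ _ hx]
    · exact (Set.indicator_of_notMem hx _).le.trans (N.hitProb_nonneg A Z F _ x)
  | succ n ih =>
    by_cases hx : x ∈ A
    · rw [hitProb_of_mem _ _ _ _ _ hx, hitProb_of_mem _ _ _ _ _ hx]
    by_cases hxZ : x ∈ Z
    · rw [hitProb_of_mem_right _ _ _ _ _ hx hxZ, hitProb_of_mem_right _ _ _ _ _ hx hxZ]
    rw [hitProb_succ _ _ _ _ _ hx hxZ, hitProb_succ _ _ _ _ _ hx hxZ]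
    exact Finset.sum_le_sum fun y _ => mul_le_mul_of_nonneg_left (ih y) (N.transProb_nonneg x y)

/-- The limits of the hitting probabilities are harmonic off `A` and `Z`. -/
theorem exists_tendsto_hitProb : ∃ p : V → ℝ,
    (∀ x, Filter.Tendsto (fun n => N.hitProb A Z F n x) Filter.atTop (nhds (p x))) ∧
    (∀ x ∈ A, p x = 1) ∧ (∀ x, 0 ≤ p x) ∧
    ∀ x, x ∉ A → x ∉ Z → p x = ∑ y ∈ F, N.transProb x y * p y := by
  have hlim : ∀ x, Filter.Tendsto (fun n => N.hitProb A Z F n x) Filter.atTop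
      (nhds (⨆ n, N.hitProb A Z F n x)) := fun x =>
    tendsto_atTop_ciSup (monotone_nat_of_le_succ fun n => N.hitProb_le_succ A Z F n x)
      ⟨1, by rintro _ ⟨n, rfl⟩; exact N.hitProb_le_one A Z F n x⟩
  refine ⟨fun x => ⨆ n, N.hitProb A Z F n x, hlim, fun x hx => ?_, fun x => ?_,
    fun x hxA hxZ => ?_⟩
  · simp [N.hitProb_of_mem A Z F _ hx]
  · exact Real.iSup_nonneg fun n => N.hitProb_nonneg A Z F n x
  · refine tendsto_nhds_unique ((hlim x).comp (Filter.tendsto_add_atTop_nat 1)) ?_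
    have : ((fun n => N.hitProb A Z F n x) ∘ fun n => n + 1) =
        fun n => ∑ y ∈ F, N.transProb x y * N.hitProb A Z F n y :=
      funext fun n => N.hitProb_succ A Z F n hxA hxZ
    rw [this]
    exact tendsto_finsetSum _ fun y _ => (hlim y).const_mul _

variable {A Z F N}

theorem IsRandomWalk.measurableSet_cylinder [MeasurableSpace V] [MeasurableSingletonClass V]
    {v : V} {Ω : Type*} [MeasurableSpace Ω] {μ : Measure Ω} {X : ℕ → Ω → V}
    (hX : N.IsRandomWalk v μ X) (k : ℕ) (x : ℕ → V) :
    MeasurableSet {ω | ∀ i ≤ k, X i ω = x i} := by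
  simp only [Set.ofPred_forall]
  exact MeasurableSet.iInter fun i => MeasurableSet.iInter fun _ =>
    hX.measurable i (measurableSet_singleton _)

/-- The Markov property for the hitting probabilities, along a path that has not hit `A ∪ Z`. -/
theorem IsRandomWalk.hitProb_mul_le [MeasurableSpace V] [MeasurableSingletonClass V]
    {v : V} {Ω : Type*} [MeasurableSpace Ω] {μ : Measure Ω} {X : ℕ → Ω → V}
    (hX : N.IsRandomWalk v μ X) (hAZ : Disjoint A Z) (n k : ℕ) (x : ℕ → V) (hx0 : x 0 = v)
    (hx : ∀ i < k, x i ∉ A ∧ x i ∉ Z) :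
    ENNReal.ofReal (N.hitProb A Z F n (x k)) * μ {ω | ∀ i ≤ k, X i ω = x i} ≤
      μ.restrict {ω | hittingAfter X A 0 ω < hittingAfter X Z 0 ω}
        {ω | ∀ i ≤ k, X i ω = x i} := by
  classical
  have hmem : ∀ (n k : ℕ) (x : ℕ → V), (∀ i < k, x i ∉ A ∧ x i ∉ Z) → x k ∈ A → ENNReal.ofReal (N.hitProb A Z F n (x k)) *
      μ {ω | ∀ i ≤ k, X i ω = x i} ≤
      μ.restrict {ω | hittingAfter X A 0 ω < hittingAfter X Z 0 ω}
        {ω | ∀ i ≤ k, X i ω = x i} := by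
    intro n k x hx hA
    rw [N.hitProb_of_mem A Z F n hA, ENNReal.ofReal_one, one_mul,
      Measure.restrict_apply (hX.measurableSet_cylinder k x)]
    refine measure_mono fun ω hω => ⟨hω, ?_⟩
    have h1 : hittingAfter X A 0 ω ≤ WithTop.some k :=
      hittingAfter_le_of_mem (Nat.zero_le k) (by rw [hω k le_rfl]; exact hA)
    refine h1.trans_lt ?_
    by_contra hcon
    rw [not_lt] at hcon
    obtain ⟨j, hj, hjZ⟩ := hittingAfter_le_iff.1 hcon
    rw [hω j hj.2] at hjZ
    rcases hj.2.lt_or_eq with h | h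
    · exact (hx j h).2 hjZ
    · rw [h] at hjZ
      exact Set.disjoint_left.1 hAZ hA hjZ
  induction n generalizing k x with
  | zero =>
    by_cases hA : x k ∈ A
    · exact hmem 0 k x hx hA
    · simp [hitProb, hA]
  | succ n ih =>
    by_cases hA : x k ∈ A
    · exact hmem _ k x hx hA
    by_cases hZ : x k ∈ Z
    · simp [N.hitProb_of_mem_right A Z F _ hA hZ]
    rw [N.hitProb_succ A Z F n hA hZ, ENNReal.ofReal_sum_of_nonneg fun y _ =>
      mul_nonneg (N.transProb_nonneg _ _) (N.hitProb_nonneg A Z F n y), Finset.sum_mul]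
    have hupd : ∀ y i, i ≤ k → Function.update x (k + 1) y i = x i := fun y i hi =>
      Function.update_of_ne (by omega) _ _
    have hupd0 : ∀ y, Function.update x (k + 1) y 0 = v := fun y => by
      rw [hupd y 0 (Nat.zero_le k), hx0]
    have hterm : ∀ y ∈ F, ENNReal.ofReal (N.transProb (x k) y * N.hitProb A Z F n y) *
        μ {ω | ∀ i ≤ k, X i ω = x i} ≤
        μ.restrict {ω | hittingAfter X A 0 ω < hittingAfter X Z 0 ω}
          {ω | ∀ i ≤ k + 1, X i ω = Function.update x (k + 1) y i} := by
      intro y _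
      have hpath : ∀ i < k + 1, Function.update x (k + 1) y i ∉ A ∧
          Function.update x (k + 1) y i ∉ Z := by
        intro i hi
        rw [hupd y i (by omega)]
        rcases (Nat.lt_succ_iff.1 hi).lt_or_eq with h | rfl
        · exact hx i h
        · exact ⟨hA, hZ⟩
      refine le_trans (le_of_eq ?_) (ih (k + 1) (Function.update x (k + 1) y) (hupd0 y) hpath)
      have hprod : ∏ i ∈ Finset.range k, ENNReal.ofReal (N.transProb
          (Function.update x (k + 1) y i) (Function.update x (k + 1) y (i + 1))) =
          ∏ i ∈ Finset.range k, ENNReal.ofReal (N.transProb (x i) (x (i + 1))) :=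
        Finset.prod_congr rfl fun i hi => by
          rw [hupd y i (Finset.mem_range.1 hi).le, hupd y (i + 1) (Finset.mem_range.1 hi)]
      rw [hX.law (k + 1) _ (hupd0 y), hX.law k x hx0, Finset.prod_range_succ, hprod,
        Function.update_self, hupd y k le_rfl, ENNReal.ofReal_mul (N.transProb_nonneg _ _)]
      ring
    refine (Finset.sum_le_sum hterm).trans ?_
    -- The measure restricted to the hitting event is additive over disjoint measurable cylinders,
    -- whether or not that event is measurable.
    rw [← measure_biUnion_finset]
    · refine measure_mono ?_
      intro ω hω
      simp only [Set.mem_iUnion] at hω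
      obtain ⟨y, _, hy⟩ := hω
      intro i hi
      rw [hy i (by omega), hupd y i hi]
    · intro y _ z _ hyz
      refine Set.disjoint_left.2 fun ω hy hz => hyz ?_
      have h1 := hy (k + 1) le_rfl
      have h2 := hz (k + 1) le_rfl
      rw [Function.update_self] at h1 h2
      exact h1.symm.trans h2
    · exact fun y _ => hX.measurableSet_cylinder _ _

theorem IsRandomWalk.hitProb_le [MeasurableSpace V] [MeasurableSingletonClass V]
    {v : V} {Ω : Type*} [MeasurableSpace Ω] {μ : Measure Ω} {X : ℕ → Ω → V}
    (hX : N.IsRandomWalk v μ X) (hAZ : Disjoint A Z) (F : Finset V) (n : ℕ) :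
    ENNReal.ofReal (N.hitProb A Z F n v) ≤
      μ {ω | hittingAfter X A 0 ω < hittingAfter X Z 0 ω} := by
  have h := hX.hitProb_mul_le (F := F) hAZ n 0 (fun _ => v) rfl (by simp)
  have hstart : μ {ω | ∀ i ≤ 0, X i ω = v} = 1 := by simpa using hX.start
  rw [hstart, mul_one] at h
  refine h.trans ((measure_mono (Set.subset_univ _)).trans ?_)
  rw [Measure.restrict_apply_univ]

end

/-- The probability that the random walk hits the inner boundary of an annulus before the outer
boundary is at least the normalized Green function. -/
theorem IsGreen.div_le_measure {N : Network squareLattice} {m n : ℤ} {a : ℤ × ℤ → ℝ}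
    (hG : N.IsGreen m n 0 a) (hm : 0 ≤ m) (hmn : m < n) {v : ℤ × ℤ} (hv : m ≤ supNorm v)
    (hvn : supNorm v ≤ n) {Ω : Type*} [MeasurableSpace Ω] {μ : Measure Ω} {X : ℕ → Ω → ℤ × ℤ}
    (hX : N.IsRandomWalk v μ X) :
    ENNReal.ofReal (a v / a 0) ≤ μ {ω | hittingAfter X (boxBoundary m) 0 ω <
      hittingAfter X (boxBoundary n) 0 ω} := by
  have hdisj : Disjoint (boxBoundary m) (boxBoundary n) :=
    Set.disjoint_left.2 fun x hx hx' => hmn.ne (hx.symm.trans hx')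
  have h0 := hG.pos_zero hm hmn
  obtain ⟨p, hlim, hpA, hpnn, hp⟩ :=
    N.exists_tendsto_hitProb (boxBoundary m) (boxBoundary n) (boxFinset n)
  have hpv : ENNReal.ofReal (p v) ≤ μ {ω | hittingAfter X (boxBoundary m) 0 ω <
      hittingAfter X (boxBoundary n) 0 ω} :=
    le_of_tendsto' (ENNReal.tendsto_ofReal (hlim v)) fun k => hX.hitProb_le hdisj _ k
  refine le_trans (ENNReal.ofReal_le_ofReal ?_) hpv
  have hpharm : ∀ x, m < supNorm x → supNorm x < n →
      ∑ y ∈ boxFinset n, N.conductance x y * (p y - p x) = 0 := by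
    intro x h1 h2
    have hsum : ∑ᶠ z, N.conductance x z = ∑ y ∈ boxFinset n, N.conductance x y := by
      refine finsum_eq_sum_of_support_subset _ fun y hy => ?_
      have := supNorm_le_of_adj (N.adj_of_conductance_ne_zero hy)
      exact mem_boxFinset.2 (by omega)
    have hpos : 0 < ∑ y ∈ boxFinset n, N.conductance x y := by
      have hr := adj_right x
      have hr' := supNorm_le_of_adj hr
      exact Finset.sum_pos' (fun y _ => N.conductance_nonneg x y)
        ⟨_, mem_boxFinset.2 (by omega), N.conductance_pos hr⟩
    have h := hp x (fun hx => h1.ne' hx) (fun hx => h2.ne hx)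
    simp only [transProb, hsum, div_mul_eq_mul_div] at h
    rw [← Finset.sum_div, eq_div_iff hpos.ne'] at h
    simp only [mul_sub, Finset.sum_sub_distrib, ← Finset.sum_mul]
    linarith
  -- `a / a 0 - p` is harmonic in the annulus, 0 on the inner boundary and at most 0 on the outer
  -- one, as `p ≥ 0` there.
  have key := le_of_subharmonic_annulus (N := N) (m := m) (n := n) (b := 0)
    (f := fun x => a x / a 0 - p x) (fun x h1 h2 => ?_) (fun x hx => ?_) (fun x hx => ?_) hv hvn
  · exact sub_nonpos.1 key
  · have e : ∑ y ∈ boxFinset n, N.conductance x y * (a y / a 0 - p y - (a x / a 0 - p x)) =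
        (∑ y ∈ boxFinset n, N.conductance x y * (a y - a x)) / a 0 -
        ∑ y ∈ boxFinset n, N.conductance x y * (p y - p x) := by
      rw [Finset.sum_div, ← Finset.sum_sub_distrib]
      exact Finset.sum_congr rfl fun y _ => by ring
    rw [e, hG.harmonic hm h1 h2, hpharm x h1 h2, zero_div, sub_zero]
  · rw [hpA x hx, hG.mem.1 x hx.le, div_self h0.ne', sub_self]
  · rw [hG.mem.2 x hx.ge, zero_div, zero_sub]
    exact neg_nonpos.2 (hpnn x)

/-- The resistance around an annulus is controlled by the Green function inside. -/
theorem resAround_le_green (N : Network squareLattice) {C : ℝ} (hC : 0 < C) {r₁ r₂ r₃ r₄ : ℤ}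
    (h₁ : 0 ≤ r₁) (h₁₂ : r₁ < r₂) (h₂₃ : r₂ < r₃) (h₃₄ : r₃ < r₄)
    (h : N.resAround r₂ r₃ ≤ C * N.resAcross r₃ r₄) {a : ℤ × ℤ → ℝ} (hG : N.IsGreen r₁ r₄ 0 a)
    {v : ℤ × ℤ} (hv : v ∈ box r₂) :
    N.resAround r₂ r₃ ≤ C * Real.exp √C * a v := by
  obtain ⟨η, hη⟩ := N.exists_isGreen r₃ r₄ 0
  rw [resAcross, N.effRes_boundary (by omega) h₃₄ hη] at h
  exact hG.resAround_le hη h₁ h₁₂.le h₂₃ h₃₄ hv hC h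

end Network

end

theorem lemma7 :
    (∀ C : ℝ, 0 < C → ∃ r : ℝ, 0 < r ∧
      ∀ (N : Network squareLattice) (r₁ r₂ r₃ r₄ : ℤ),
        0 ≤ r₁ → r₁ < r₂ → r₂ < r₃ → r₃ < r₄ →
        N.resAround r₂ r₃ ≤ C * N.resAcross r₃ r₄ →
        ∀ v ∈ box r₂ \ box r₁,
          r * N.resAround r₂ r₃ ≤
            N.effRes {v} (boxBoundary r₄) (boxBoundary r₁)
              + N.effRes (boxBoundary r₁) (boxBoundary r₄) ∅
              - N.effRes {v} (boxBoundary r₁) (boxBoundary r₄)) ∧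
    (∀ c C : ℝ, 0 < c → 0 < C → ∃ q : ℝ, 0 < q ∧ q < 1 ∧
      ∀ (N : Network squareLattice) (r₁ r₂ r₃ r₄ : ℤ),
        0 ≤ r₁ → r₁ < r₂ → r₂ < r₃ → r₃ < r₄ →
        c * N.effRes (boxBoundary r₁) (boxBoundary r₄) ∅ ≤ N.resAround r₂ r₃ →
        N.resAround r₂ r₃ ≤ C * N.resAcross r₃ r₄ →
        ∀ v ∈ box r₂ \ box r₁,
        ∀ (Ω : Type*) [MeasurableSpace Ω] (μ : MeasureTheory.Measure Ω)
          [MeasureTheory.IsProbabilityMeasure μ] (X : ℕ → Ω → ℤ × ℤ),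
          N.IsRandomWalk v μ X →
          ENNReal.ofReal q ≤
            μ {ω | MeasureTheory.hittingAfter X (boxBoundary r₁) 0 ω <
              MeasureTheory.hittingAfter X (boxBoundary r₄) 0 ω}) := by
  -- The 2 comes from the identity with 2a(v); `c` enters (ii) through a(A) = R(A,Z); the minimum
  -- with 1/2 only ensures q < 1.
  refine ⟨fun C hC => ⟨2 / (C * Real.exp √C), by positivity, ?_⟩,
    fun c C hc hC => ⟨min (1 / 2) (c / (C * Real.exp √C)), by positivity,
      (min_le_left _ _).trans_lt (by norm_num), ?_⟩⟩
  · intro N r₁ r₂ r₃ r₄ h₁ h₁₂ h₂₃ h₃₄ h v hv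
    have hv₁ : r₁ < supNorm v := not_le.1 hv.2
    have hv₂ : supNorm v ≤ r₂ := hv.1
    obtain ⟨a, ha⟩ := N.exists_isGreen r₁ r₄ 0
    obtain ⟨g, hg⟩ := N.exists_isGreen r₁ r₄ v
    rw [N.effRes_add_effRes_sub_effRes h₁ (by omega) hv₁ (by omega) ha hg, div_mul_eq_mul_div,
      div_le_iff₀ (by positivity)]
    have := N.resAround_le_green hC h₁ h₁₂ h₂₃ h₃₄ h ha hv.1
    linarith
  · intro N r₁ r₂ r₃ r₄ h₁ h₁₂ h₂₃ h₃₄ hc' h v hv Ω _ μ _ X hX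
    have hv₁ : r₁ < supNorm v := not_le.1 hv.2
    have hv₂ : supNorm v ≤ r₂ := hv.1
    have h₁₄ : r₁ < r₄ := by omega
    obtain ⟨a, ha⟩ := N.exists_isGreen r₁ r₄ 0
    refine le_trans (ENNReal.ofReal_le_ofReal ?_)
      (ha.div_le_measure h₁ h₁₄ hv₁.le (by omega) hX)
    refine (min_le_right _ _).trans ?_
    rw [div_le_div_iff₀ (by positivity) (ha.pos_zero h₁ h₁₄)]
    have h₅ := N.resAround_le_green hC h₁ h₁₂ h₂₃ h₃₄ h ha hv.1
    rw [N.effRes_boundary h₁ h₁₄ ha] at hc'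
    linarith
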